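/- Fix an integer $d\ge 2$ and let $P$ be a polynomial of degree $2$ in $d$ variables with integer coefficients which is irreducible over $\mathbb Q$. Let $Z=\{x\in\mathbb R^d: P(x)=0\}$ and $Z_{\mathrm{reg}}=\{x\in Z:\nabla P(x)\neq 0\}$. For $x\in Z$ let $\omega_Z(x)\in[-\infty,\infty]$ be the supremum of the $c>0$ for which there is a constant $C$ such that infinitely many rational points $\frac{\mathbf p}{q}\in\mathbb Q^d\cap Z$ (written in lowest terms, with $q\geq 1$) satisfy $\|x-\frac{\mathbf p}{q}\|\le C q^{-c}$, where $\|\cdot\|$ is the max norm; for $c\in\mathbb R$ let $W_{c,Z}=\{x\in Z:\omega_Z(x)>c\}$. Let $\alpha,\delta>0$ and let $\mu$ be a locally finite Borel measure on $\mathbb R^{d-1}$ for which there are $\rho_0>0$ and $C>0$ such that for all $x\in\operatorname{Supp}\mu$ and all $0<\rho\le\rho_0$: (i) $\mu\big(B(x,\rho)\cap \mathcal L^{(\epsilon\rho)}\big)\le C\epsilon^{\alpha}\mu(B(x,\rho))$ for every affine hyperplane $\mathcal L\subset\mathbb R^{d-1}$ and every $\epsilon>0$, where $\mathcal L^{(r)}$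 is the set of points at distance at most $r$ from $\mathcal L$; (ii) $\mu(B(x,2\rho))\le C\mu(B(x,\rho))$; (iii) $C^{-1}\rho^\delta\le\mu(B(x,\rho))\le C\rho^\delta$. (Conditions (i) and (ii) say that $\mu$ is absolutely $\alpha$-friendly, and (iii) that it is Ahlfors $\delta$-regular; balls are closed and Euclidean.) Let $U\subset\mathbb R^{d-1}$ be an open set containing $\operatorname{Supp}\mu$, let $\Psi:U\to Z_{\mathrm{reg}}$ be a local coordinate chart (a $C^2$ immersion, for instance a $C^\infty$ one, which is a homeomorphism onto a relatively open subset of $Z_{\mathrm{reg}}$), and let $\nu=\Psi[\mu]$ be the push-forward of $\mu$. Then for every $c\ge 1$, $$\operatorname{HD}\big(W_{c,Z}\cap\operatorname{Supp}(\nu)\cap\Psi(U)\big)\le\delta-\alpha\Big(1-\frac1c\Big),$$ where $\operatorname{HD}$ is Hausdorff dimension (for the trivial measure $\mu=0$ a negative right-hand side is read as $0$). If moreover $\operatorname{Supp}\mu$ is compact, then $$\operatorname{HD}\big(W_{c,Z}\cap\operatorname{Supp}(\nu)\big)\le\delta-\alpha\Big(1-\frac1c\Big).$$ -/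

import Mathlib

open MeasureTheory

namespace IntrinsicApprox

/-! ### Absolutely friendly and Ahlfors regular measures on `ℝᵏ` -/

/-- `L` is an affine hyperplane of `ℝᵏ`: the solution set of one nontrivial affine equation. -/
def IsAffineHyperplane {k : ℕ} (L : Set (EuclideanSpace ℝ (Fin k))) : Prop :=
  ∃ (w : EuclideanSpace ℝ (Fin k)) (t : ℝ), w ≠ 0 ∧ L = {y | inner ℝ w y = t}

/-- `μ` is absolutely `α`-decaying: for some `ρ₀ > 0` and some constant `C`, all `0 < ρ ≤ ρ₀`,
all `x ∈ Supp μ`, all affine hyperplanes `L` and all `ε > 0`, the closed `ερ`-thickening of `L`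
satisfies `μ (B(x,ρ) ∩ L^(ερ)) ≤ C ε^α μ (B(x,ρ))`. -/
def IsAbsolutelyDecaying {k : ℕ} (α : ℝ) (μ : Measure (EuclideanSpace ℝ (Fin k))) : Prop :=
  0 < α ∧ ∃ ρ₀ : ℝ, 0 < ρ₀ ∧ ∃ C : ℝ, 0 < C ∧
    ∀ ρ : ℝ, 0 < ρ → ρ ≤ ρ₀ → ∀ x ∈ μ.support,
      ∀ L : Set (EuclideanSpace ℝ (Fin k)), IsAffineHyperplane L → ∀ ε : ℝ, 0 < ε →
        μ (Metric.closedBall x ρ ∩ Metric.cthickening (ε * ρ) L) ≤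
          ENNReal.ofReal (C * ε ^ α) * μ (Metric.closedBall x ρ)

/-- The Federer (doubling) condition at points of the support and at small scales. -/
def IsFederer {k : ℕ} (μ : Measure (EuclideanSpace ℝ (Fin k))) : Prop :=
  ∃ ρ₀ : ℝ, 0 < ρ₀ ∧ ∃ C : ℝ, 0 < C ∧
    ∀ x ∈ μ.support, ∀ ρ : ℝ, 0 < ρ → ρ ≤ ρ₀ →
      μ (Metric.closedBall x (2 * ρ)) ≤ ENNReal.ofReal C * μ (Metric.closedBall x ρ)

/-- `μ` is absolutely `α`-friendly: locally finite, absolutely `α`-decaying and Federer. -/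
structure IsAbsolutelyFriendly {k : ℕ} (α : ℝ) (μ : Measure (EuclideanSpace ℝ (Fin k))) :
    Prop where
  locallyFinite : IsLocallyFiniteMeasure μ
  decaying : IsAbsolutelyDecaying α μ
  federer : IsFederer μ

/-- `μ` is Ahlfors `δ`-regular: `μ (B(x,ρ))` is comparable to `ρ^δ`, uniformly over
`x ∈ Supp μ` and `0 < ρ ≤ ρ₀`. -/
def IsAhlforsRegular {k : ℕ} (δ : ℝ) (μ : Measure (EuclideanSpace ℝ (Fin k))) : Prop :=
  0 < δ ∧ ∃ ρ₀ : ℝ, 0 < ρ₀ ∧ ∃ C : ℝ, 0 < C ∧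
    ∀ x ∈ μ.support, ∀ ρ : ℝ, 0 < ρ → ρ ≤ ρ₀ →
      ENNReal.ofReal (C⁻¹ * ρ ^ δ) ≤ μ (Metric.closedBall x ρ) ∧
        μ (Metric.closedBall x ρ) ≤ ENNReal.ofReal (C * ρ ^ δ)

/-! ### The hypersurface `Z_P`, its regular part and its charts -/

/-- The real zero set `Z_P ⊆ ℝᵈ` of an integral polynomial `P` in `d` variables. -/
def zeroSet {d : ℕ} (P : MvPolynomial (Fin d) ℤ) : Set (EuclideanSpace ℝ (Fin d)) :=
  {x | MvPolynomial.aeval (fun i => x i) P = 0}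

/-- The regular part of `Z_P`: the points of `Z_P` at which `∇P ≠ 0`. -/
def regularPart {d : ℕ} (P : MvPolynomial (Fin d) ℤ) : Set (EuclideanSpace ℝ (Fin d)) :=
  {x | x ∈ zeroSet P ∧ ∃ i, MvPolynomial.aeval (fun j => x j) (MvPolynomial.pderiv i P) ≠ 0}

/-- `Ψ : U → M` is a local coordinate chart (local parametrization) of class `Cⁿ` of `M ⊆ ℝᵈ`:
`U ⊆ ℝᵏ` is open, and `Ψ` is a `Cⁿ` immersion on `U` which is a homeomorphism onto a relatively
open subset of `M`. The values of `Ψ` outside `U` are irrelevant. -/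
structure IsLocalChart {k d : ℕ} (n : WithTop ℕ∞) (U : Set (EuclideanSpace ℝ (Fin k)))
    (Ψ : EuclideanSpace ℝ (Fin k) → EuclideanSpace ℝ (Fin d))
    (M : Set (EuclideanSpace ℝ (Fin d))) : Prop where
  isOpen_source : IsOpen U
  contDiffOn : ContDiffOn ℝ n Ψ U
  injective_fderiv : ∀ x ∈ U, Function.Injective (fderiv ℝ Ψ x)
  isEmbedding : Topology.IsEmbedding (fun x : U => Ψ x)
  isOpen_image : ∃ V : Set (EuclideanSpace ℝ (Fin d)), IsOpen V ∧ Ψ '' U = V ∩ M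

/-! ### Intrinsic approximation -/

/-- The rational points `p / q` of `Z_P`, each listed once, as the pair `(p, q)` with `q` positive
and `gcd (p₁, …, p_d, q) = 1`. -/
def rationalPoints {d : ℕ} (P : MvPolynomial (Fin d) ℤ) : Set ((Fin d → ℤ) × ℕ) :=
  {r | 0 < r.2 ∧ (∀ e : ℕ, e ∣ r.2 → (∀ i, (e : ℤ) ∣ r.1 i) → e = 1) ∧
    MvPolynomial.aeval (fun i => (r.1 i : ℚ) / (r.2 : ℚ)) P = 0}

/-- The intrinsic exponent `ω_Z(x)`: the supremum, in the extended reals, of the `c > 0` for which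
there is `C` such that infinitely many rational points `p / q` of `Z_P` satisfy
`‖x - p / q‖ ≤ C / q ^ c` in the max norm. -/
noncomputable def intrinsicExponent {d : ℕ} (P : MvPolynomial (Fin d) ℤ)
    (x : EuclideanSpace ℝ (Fin d)) : EReal :=
  sSup ((fun c : ℝ => (c : EReal)) '' {c : ℝ | 0 < c ∧ ∃ C : ℝ,
    {r ∈ rationalPoints P |
      ∀ i, |x i - (r.1 i : ℝ) / (r.2 : ℝ)| ≤ C / (r.2 : ℝ) ^ c}.Infinite})

/-- `W_{c,Z}`: the points of `Z_P` whose intrinsic exponent exceeds `c`. -/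
def wellApproximable {d : ℕ} (P : MvPolynomial (Fin d) ℤ) (c : ℝ) :
    Set (EuclideanSpace ℝ (Fin d)) :=
  {x | x ∈ zeroSet P ∧ (c : EReal) < intrinsicExponent P x}

end IntrinsicApprox

/-!
# Well approximable points of a quadric hypersurface in the support of a friendly measure

Two rational points `p / q`, `p' / q'` of the quadric satisfy an arithmetic repulsion: the quadratic
part `Q` of the polynomial takes at their difference a value in `(q q')⁻¹ ℤ`
(`exists_int_form_sub`). So if both denominators are below `2 ^ (n + 1)` and the points are at
distance at most a small multiple of `2 ^ (-n)`, then `Q` vanishes at the difference, which is then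
also tangent to the quadric at either point. All such rational points near a given place therefore
lie in an affine subspace on which the polynomial vanishes identically. This subspace is smaller
than the tangent hyperplane at one of the points, since otherwise the equation of this rational
hyperplane would divide the polynomial (`exists_tangent_form_ne_zero`). Hence these points lie in an
affine hyperplane whose unit normal `w` is tangent to the quadric (`exists_unit_normal`), and the
function `⟨w, Ψ ·⟩` has no critical point there: in the chart, the relevant set is close to a
uniformly regular `C²` hypersurface.

An absolutely `α`-decaying, Ahlfors `δ`-regular measure controls how many `r`-separated points of
its support lie in a ball of radius `ρ` and within `r` of a hyperplane: at most a constant times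
`(ρ / r) ^ (δ - α)`. The same bound holds for a regular `C²` hypersurface as long as `r` is at least
a fixed power of `ρ`: it is flat up to `O(ρ²)` on a ball of radius `ρ`, and one passes successively
to balls of radius `ρ²`, `ρ⁴`, … (`DecayEstimate.card_le_of_near_hypersurface`).

With `ρ` comparable to `2 ^ (-n)` and `r` to `2 ^ (-n c)`, the points that have a rational
approximation with denominator about `2 ^ n` and error at most `r` are covered by
`O(ρ ^ (-δ) (ρ / r) ^ (δ - α))` balls of radius `r`, and the Borel–Cantelli argument
`dimH_limsup_le` gives the bound `δ - α (1 - 1 / c)`.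
-/

namespace IntrinsicApprox

/-! ### Counting separated points of the support near a hypersurface -/

/-- Distinct points of `S` are at distance greater than `r`. -/
def Separated {X : Type*} [PseudoMetricSpace X] (r : ℝ) (S : Finset X) : Prop :=
  (S : Set X).Pairwise fun x y => r < dist x y

lemma Separated.mono {X : Type*} [PseudoMetricSpace X] {r : ℝ} {S T : Finset X}
    (hS : Separated r S) (h : T ⊆ S) : Separated r T :=
  Set.Pairwise.mono (by exact_mod_cast h) hS

/-- A bound for the size of the `r`-separated subsets of `A` yields a maximal one, and the balls
of radius `r` around its points cover `A`. -/
lemma exists_separated_cover {X : Type*} [PseudoMetricSpace X] (A : Set X) {r : ℝ} (hr : 0 ≤ r)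
    (N : ℝ) (h : ∀ S : Finset X, (S : Set X) ⊆ A → Separated r S → (S.card : ℝ) ≤ N) :
    ∃ T : Finset X, (T : Set X) ⊆ A ∧ Separated r T ∧ ∀ a ∈ A, ∃ t ∈ T, dist a t ≤ r := by
  classical
  let p : ℕ → Prop := fun n => ∃ S : Finset X, (S : Set X) ⊆ A ∧ Separated r S ∧ S.card = n
  have hp0 : p 0 := ⟨∅, by simp, by simp [Separated], rfl⟩
  have hb : ∀ n, p n → n ≤ ⌊N⌋₊ := by
    rintro n ⟨S, h1, h2, rfl⟩
    exact Nat.le_floor (h S h1 h2)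
  obtain ⟨T, hTA, hTs, hTc⟩ : p (Nat.findGreatest p ⌊N⌋₊) :=
    Nat.findGreatest_spec (P := p) (Nat.zero_le _) hp0
  refine ⟨T, hTA, hTs, fun a ha => ?_⟩
  by_contra! hcon
  have haT : a ∉ T := fun h' => by
    have := hcon a h'
    simp at this
    linarith
  have hp : p (T.card + 1) := by
    refine ⟨insert a T, ?_, ?_, Finset.card_insert_of_notMem haT⟩
    · rw [Finset.coe_insert]
      exact Set.insert_subset ha hTA
    · rw [Separated, Finset.coe_insert]
      refine (Set.pairwise_insert).2 ⟨hTs, fun b hb _ => ⟨hcon b hb, ?_⟩⟩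
      rw [dist_comm]
      exact hcon b hb
  have := Nat.le_findGreatest (hb _ hp) hp
  omega

/-- The two estimates on `μ` that the counting argument uses, with common constants: a lower bound
for the measure of small balls, and the product of the decay estimate with the upper bound for
the measure of small balls. -/
structure DecayEstimate {k : ℕ} (μ : Measure (EuclideanSpace ℝ (Fin k)))
    (α δ ρ₀ a C : ℝ) : Prop where
  rho_pos : 0 < ρ₀
  low_pos : 0 < a
  const_pos : 0 < C
  low : ∀ x ∈ μ.support, ∀ ρ : ℝ, 0 < ρ → ρ ≤ ρ₀ →
    ENNReal.ofReal (a * ρ ^ δ) ≤ μ (Metric.closedBall x ρ)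
  decay : ∀ x ∈ μ.support, ∀ ρ : ℝ, 0 < ρ → ρ ≤ ρ₀ →
    ∀ (w : EuclideanSpace ℝ (Fin k)) (t : ℝ), w ≠ 0 → ∀ ε : ℝ, 0 < ε →
      μ (Metric.closedBall x ρ ∩ Metric.cthickening (ε * ρ) {y | inner ℝ w y = t}) ≤
        ENNReal.ofReal (C * ε ^ α * ρ ^ δ)

lemma exists_decayEstimate {k : ℕ} {μ : Measure (EuclideanSpace ℝ (Fin k))} {α δ : ℝ}
    (hd : IsAbsolutelyDecaying α μ) (hr : IsAhlforsRegular δ μ) :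
    ∃ ρ₀ a C, DecayEstimate μ α δ ρ₀ a C := by
  obtain ⟨-, ρ₁, hρ₁, C₁, hC₁, h₁⟩ := hd
  obtain ⟨-, ρ₂, hρ₂, C₂, hC₂, h₂⟩ := hr
  refine ⟨min ρ₁ ρ₂, C₂⁻¹, C₁ * C₂, lt_min hρ₁ hρ₂, by positivity, by positivity, ?_, ?_⟩
  · intro x hx ρ h0 h
    exact (h₂ x hx ρ h0 (h.trans (min_le_right _ _))).1
  · intro x hx ρ h0 h w t hw ε hε
    refine (h₁ ρ h0 (h.trans (min_le_left _ _)) x hx _ ⟨w, t, hw, rfl⟩ ε hε).trans ?_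
    refine (mul_le_mul_right (h₂ x hx ρ h0 (h.trans (min_le_right _ _))).2 _).trans ?_
    rw [← ENNReal.ofReal_mul (by positivity)]
    apply le_of_eq
    congr 1
    ring

section Counting

variable {k : ℕ} {μ : Measure (EuclideanSpace ℝ (Fin k))} {α δ ρ₀ a C : ℝ}

/-- The volume bound: the balls of radius `r / 3` around the points of an `r`-separated set are
disjoint. -/
lemma DecayEstimate.card_mul_le (h : DecayEstimate μ α δ ρ₀ a C)
    {S : Finset (EuclideanSpace ℝ (Fin k))} {r m : ℝ} (hr : 0 < r) (hrρ : r ≤ ρ₀) (hm : 0 ≤ m)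
    (hS : Separated r S) (hsupp : ∀ s ∈ S, s ∈ μ.support)
    {A : Set (EuclideanSpace ℝ (Fin k))} (hA : ∀ s ∈ S, Metric.closedBall s (r / 3) ⊆ A)
    (hμA : μ A ≤ ENNReal.ofReal m) : (S.card : ℝ) * (a * (r / 3) ^ δ) ≤ m := by
  have ha := h.low_pos
  have hdisj : Set.PairwiseDisjoint (S : Set (EuclideanSpace ℝ (Fin k)))
      (fun s => Metric.closedBall s (r / 3)) := by
    intro x hx y hy hxy
    apply Metric.closedBall_disjoint_closedBall
    have := hS hx hy hxy
    linarith
  have h1 : ∑ s ∈ S, μ (Metric.closedBall s (r / 3)) ≤ μ A := by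
    rw [← measure_biUnion_finset hdisj (fun s _ => Metric.isClosed_closedBall.measurableSet)]
    exact measure_mono (Set.iUnion₂_subset hA)
  have h2 : ∑ s ∈ S, ENNReal.ofReal (a * (r / 3) ^ δ) ≤
      ∑ s ∈ S, μ (Metric.closedBall s (r / 3)) :=
    Finset.sum_le_sum fun s hs => h.low s (hsupp s hs) _ (by positivity) (by linarith)
  have h3 := (h2.trans h1).trans hμA
  rw [Finset.sum_const, nsmul_eq_mul, ← ENNReal.ofReal_natCast,
    ← ENNReal.ofReal_mul (by positivity)] at h3
  exact (ENNReal.ofReal_le_ofReal_iff hm).1 h3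

lemma mem_cthickening_hyperplane {w y : EuclideanSpace ℝ (Fin k)} {t b : ℝ} (hw : w ≠ 0)
    (h : |inner ℝ w y - t| ≤ b * ‖w‖) :
    y ∈ Metric.cthickening b {z | inner ℝ w z = t} := by
  have hw' : 0 < ‖w‖ := norm_pos_iff.2 hw
  refine Metric.mem_cthickening_of_dist_le y (y - ((inner ℝ w y - t) / ‖w‖ ^ 2) • w) _ _ ?_ ?_
  · simp only [Set.mem_ofPred_eq, inner_sub_right, inner_smul_right,
      real_inner_self_eq_norm_sq]
    field_simp
    ring
  · rw [dist_eq_norm, sub_sub_cancel, norm_smul, Real.norm_eq_abs, abs_div,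
      abs_of_nonneg (sq_nonneg ‖w‖)]
    rw [div_mul_eq_mul_div, div_le_iff₀ (by positivity)]
    nlinarith

/-- Inside a ball of radius `ρ`, an `r`-separated subset of the support which lies within `K r` of
a hyperplane has at most a constant times `(ρ / r) ^ (δ - α)` points. -/
lemma DecayEstimate.card_le_of_near_hyperplane (h : DecayEstimate μ α δ ρ₀ a C) {K : ℝ}
    (hK : 0 ≤ K) : ∃ C₁ : ℝ, 1 ≤ C₁ ∧ ∀ x ∈ μ.support, ∀ r ρ : ℝ, 0 < r → r ≤ ρ → 2 * ρ ≤ ρ₀ →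
      ∀ (w : EuclideanSpace ℝ (Fin k)) (t : ℝ), w ≠ 0 →
      ∀ S : Finset (EuclideanSpace ℝ (Fin k)), Separated r S → (∀ s ∈ S, s ∈ μ.support) →
        (∀ s ∈ S, dist s x ≤ ρ) → (∀ s ∈ S, |inner ℝ w s - t| ≤ K * r * ‖w‖) →
        (S.card : ℝ) ≤ C₁ * (ρ / r) ^ (δ - α) := by
  have ha := h.low_pos
  have hC := h.const_pos
  refine ⟨max 1 (C / a * (3 ^ δ * 2 ^ δ * ((K + 1) / 2) ^ α)), le_max_left _ _, ?_⟩
  intro x hx r ρ hr hrρ hρ w t hw S hS hsupp hball hnear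
  have hρ0 : 0 < ρ := hr.trans_le hrρ
  have hcount := h.card_mul_le (m := C * ((K + 1) * r / (2 * ρ)) ^ α * (2 * ρ) ^ δ) hr
    (by linarith) (by positivity) hS hsupp
    (A := Metric.closedBall x (2 * ρ) ∩
      Metric.cthickening ((K + 1) * r / (2 * ρ) * (2 * ρ)) {y | inner ℝ w y = t})
    (by
      intro s hs y hy
      rw [Metric.mem_closedBall] at hy
      refine ⟨?_, ?_⟩
      · rw [Metric.mem_closedBall]
        linarith [dist_triangle y s x, hball s hs]
      · rw [div_mul_cancel₀ _ (by positivity)]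
        apply mem_cthickening_hyperplane hw
        have h1 : inner ℝ w y - t = inner ℝ w (y - s) + (inner ℝ w s - t) := by
          rw [inner_sub_right]; ring
        have h2 : |inner ℝ w (y - s)| ≤ ‖w‖ * (r / 3) := by
          refine (abs_real_inner_le_norm _ _).trans ?_
          rw [← dist_eq_norm]
          gcongr
        rw [h1]
        refine (abs_add_le _ _).trans ?_
        have := hnear s hs
        nlinarith [norm_nonneg w, mul_nonneg hr.le (norm_nonneg w)])
    (h.decay x hx (2 * ρ) (by positivity) hρ w t hw _ (by positivity))
  refine le_trans ?_ (mul_le_mul_of_nonneg_right (le_max_right _ _) (by positivity))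
  rw [← le_div_iff₀ (by positivity)] at hcount
  refine hcount.trans (le_of_eq ?_)
  rw [Real.rpow_sub (by positivity), show (K + 1) * r / (2 * ρ) = (K + 1) / 2 * (r / ρ) by
    field_simp]
  rw [Real.mul_rpow (by positivity) (by positivity), Real.mul_rpow (by positivity) (by positivity),
    Real.div_rpow hr.le hρ0.le, Real.div_rpow hr.le (by norm_num), Real.div_rpow hρ0.le hr.le,
    Real.div_rpow hρ0.le hr.le]
  have : r ^ α ≠ 0 := by positivity
  have : r ^ δ ≠ 0 := by positivity
  have : ρ ^ α ≠ 0 := by positivity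
  have : ρ ^ δ ≠ 0 := by positivity
  have : (3 : ℝ) ^ δ ≠ 0 := by positivity
  field_simp

/-- The estimate near a hypersurface `f = 0`. In a ball of radius `ρ` a hypersurface is within
`O(ρ²)` of a hyperplane only, which settles the thicknesses `r ≥ ρ²`. A smaller thickness is
reached by passing to balls of radius `ρ²` and iterating, with a number of steps that is bounded
as long as `r` is at least a fixed power of `ρ`. -/
lemma DecayEstimate.card_le_of_near_hypersurface (h : DecayEstimate μ α δ ρ₀ a C) {K M c₀ : ℝ}
    (hK : 0 ≤ K) (hM : 0 ≤ M) (hc₀ : 0 < c₀) (j : ℕ) :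
    ∃ C₁ : ℝ, 0 < C₁ ∧ ∀ (D : Set (EuclideanSpace ℝ (Fin k)))
      (f : EuclideanSpace ℝ (Fin k) → ℝ) (G : EuclideanSpace ℝ (Fin k) → EuclideanSpace ℝ (Fin k)),
      (∀ x ∈ D, c₀ ≤ ‖G x‖) →
      (∀ x ∈ D, ∀ y ∈ D, |f y - f x - inner ℝ (G x) (y - x)| ≤ M * dist y x ^ 2) →
      ∀ r ρ : ℝ, 0 < r → r ≤ ρ → 2 * ρ ≤ ρ₀ → ρ ≤ 1 → ρ ^ (2 ^ j) ≤ r →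
      ∀ x ∈ μ.support, x ∈ D → ∀ S : Finset (EuclideanSpace ℝ (Fin k)), Separated r S →
        (∀ s ∈ S, s ∈ μ.support) → (∀ s ∈ S, s ∈ D) → (∀ s ∈ S, dist s x ≤ ρ) →
        (∀ s ∈ S, |f s| ≤ K * r) → (S.card : ℝ) ≤ C₁ * (ρ / r) ^ (δ - α) := by
  classical
  obtain ⟨B, hB1, hB⟩ := h.card_le_of_near_hyperplane (K := (K + M) / c₀) (by positivity)
  have base : ∀ (D : Set (EuclideanSpace ℝ (Fin k)))
      (f : EuclideanSpace ℝ (Fin k) → ℝ) (G : EuclideanSpace ℝ (Fin k) → EuclideanSpace ℝ (Fin k)),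
      (∀ x ∈ D, c₀ ≤ ‖G x‖) →
      (∀ x ∈ D, ∀ y ∈ D, |f y - f x - inner ℝ (G x) (y - x)| ≤ M * dist y x ^ 2) →
      ∀ r ρ : ℝ, 0 < r → r ≤ ρ → 2 * ρ ≤ ρ₀ → ρ ^ 2 ≤ r →
      ∀ x ∈ μ.support, x ∈ D → ∀ S : Finset (EuclideanSpace ℝ (Fin k)), Separated r S →
        (∀ s ∈ S, s ∈ μ.support) → (∀ s ∈ S, s ∈ D) → (∀ s ∈ S, dist s x ≤ ρ) →
        (∀ s ∈ S, |f s| ≤ K * r) → (S.card : ℝ) ≤ B * (ρ / r) ^ (δ - α) := by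
    intro D f G hG hf r ρ hr hrρ hρ hr2 x hx hxD S hS hsupp hSD hball hfS
    have hGx : 0 < ‖G x‖ := hc₀.trans_le (hG x hxD)
    refine hB x hx r ρ hr hrρ hρ (G x) (inner ℝ (G x) x - f x) (norm_pos_iff.1 hGx) S hS hsupp
      hball ?_
    intro s hs
    have h1 := hf x hxD s (hSD s hs)
    have h2 : M * dist s x ^ 2 ≤ M * r := by
      gcongr
      refine le_trans ?_ hr2
      have := hball s hs
      gcongr
    have h3 : inner ℝ (G x) s - (inner ℝ (G x) x - f x) =
        f s - (f s - f x - inner ℝ (G x) (s - x)) := by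
      rw [inner_sub_right]; ring
    rw [h3]
    refine (abs_sub _ _).trans ?_
    calc |f s| + |f s - f x - inner ℝ (G x) (s - x)| ≤ K * r + M * r := by
          linarith [hfS s hs]
      _ = (K + M) / c₀ * r * c₀ := by field_simp
      _ ≤ (K + M) / c₀ * r * ‖G x‖ := by
          have := hG x hxD
          gcongr
  refine ⟨B ^ (j + 1), by positivity, ?_⟩
  intro D f G hG hf
  induction j with
  | zero =>
    intro r ρ hr hrρ hρ hρ1 hrj x hx hxD S hS hsupp hSD hball hfS
    rw [zero_add, pow_one]
    refine base D f G hG hf r ρ hr hrρ hρ ?_ x hx hxD S hS hsupp hSD hball hfS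
    have : 0 < ρ := hr.trans_le hrρ
    simp at hrj
    nlinarith
  | succ j ih =>
    intro r ρ hr hrρ hρ hρ1 hrj x hx hxD S hS hsupp hSD hball hfS
    have hρ0 : 0 < ρ := hr.trans_le hrρ
    by_cases hr2 : ρ ^ 2 ≤ r
    · refine (base D f G hG hf r ρ hr hrρ hρ hr2 x hx hxD S hS hsupp hSD hball hfS).trans ?_
      gcongr
      exact le_self_pow₀ hB1 (by omega)
    · push Not at hr2
      have hρρ : ρ ^ 2 ≤ ρ := by nlinarith
      -- the base case at thickness `ρ ^ 2` counts the balls of radius `ρ ^ 2` that are needed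
      obtain ⟨T, hTS, hTsep, hTcov⟩ := exists_separated_cover
        (S : Set (EuclideanSpace ℝ (Fin k))) (sq_nonneg ρ) S.card
        (fun S' h' _ => by exact_mod_cast Finset.card_le_card (Finset.coe_subset.1 h'))
      have hTS' : ∀ t ∈ T, t ∈ S := fun t ht => hTS ht
      have hT : (T.card : ℝ) ≤ B * (ρ / ρ ^ 2) ^ (δ - α) := by
        refine base D f G hG hf (ρ ^ 2) ρ (by positivity) hρρ hρ le_rfl x hx hxD T hTsep
          (fun s hs => hsupp s (hTS' s hs)) (fun s hs => hSD s (hTS' s hs))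
          (fun s hs => hball s (hTS' s hs)) (fun s hs => (hfS s (hTS' s hs)).trans ?_)
        gcongr
      have hpiece : ∀ t ∈ T, ((S.filter fun s => dist s t ≤ ρ ^ 2).card : ℝ) ≤
          B ^ (j + 1) * (ρ ^ 2 / r) ^ (δ - α) := by
        intro t ht
        have htS := hTS' t ht
        refine ih r (ρ ^ 2) hr hr2.le (by linarith) (by linarith) ?_ t (hsupp t htS) (hSD t htS) _
          (hS.mono (Finset.filter_subset _ _)) ?_ ?_ ?_ ?_
        · rwa [← pow_mul, ← pow_succ']
        · exact fun s hs => hsupp s (Finset.mem_filter.1 hs).1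
        · exact fun s hs => hSD s (Finset.mem_filter.1 hs).1
        · exact fun s hs => (Finset.mem_filter.1 hs).2
        · exact fun s hs => hfS s (Finset.mem_filter.1 hs).1
      have hsub : S ⊆ T.biUnion fun t => S.filter fun s => dist s t ≤ ρ ^ 2 := by
        intro s hs
        obtain ⟨t, ht, hst⟩ := hTcov s hs
        exact Finset.mem_biUnion.2 ⟨t, ht, Finset.mem_filter.2 ⟨hs, hst⟩⟩
      calc (S.card : ℝ) ≤ ((∑ t ∈ T, (S.filter fun s => dist s t ≤ ρ ^ 2).card : ℕ) : ℝ) := by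
            exact_mod_cast (Finset.card_le_card hsub).trans Finset.card_biUnion_le
        _ = ∑ t ∈ T, ((S.filter fun s => dist s t ≤ ρ ^ 2).card : ℝ) := by push_cast; rfl
        _ ≤ ∑ t ∈ T, B ^ (j + 1) * (ρ ^ 2 / r) ^ (δ - α) := Finset.sum_le_sum hpiece
        _ = T.card * (B ^ (j + 1) * (ρ ^ 2 / r) ^ (δ - α)) := by
            rw [Finset.sum_const, nsmul_eq_mul]
        _ ≤ B * (ρ / ρ ^ 2) ^ (δ - α) * (B ^ (j + 1) * (ρ ^ 2 / r) ^ (δ - α)) := by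
            gcongr
        _ = B ^ (j + 1 + 1) * ((ρ / ρ ^ 2) ^ (δ - α) * (ρ ^ 2 / r) ^ (δ - α)) := by ring
        _ = B ^ (j + 1 + 1) * (ρ / r) ^ (δ - α) := by
            rw [← Real.mul_rpow (by positivity) (by positivity)]
            congr 2
            field_simp

end Counting

/-! ### Hausdorff dimension of a limit superior -/

/-- Borel–Cantelli for Hausdorff dimension: if `E n` is covered by `N n` balls of radius `r n` and
`∑ N n (2 r n) ^ s` is dominated by a geometric series, then the set of points lying in infinitely
many `E n` has dimension at most `s`. -/
lemma dimH_limsup_le {X : Type*} [MetricSpace X] {E : ℕ → Set X} {N : ℕ → ℝ} {r : ℕ → ℝ}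
    {s A q : ℝ} (hs : 0 < s) (hr0 : ∀ n, 0 < r n) (hr : Filter.Tendsto r Filter.atTop (nhds 0))
    (hA : 0 ≤ A) (hq0 : 0 ≤ q) (hq1 : q < 1)
    (hsum : ∀ n, N n * (2 * r n) ^ s ≤ A * q ^ n) {n₀ : ℕ}
    (hcov : ∀ n ≥ n₀, ∃ T : Finset X, (T.card : ℝ) ≤ N n ∧
      ∀ x ∈ E n, ∃ t ∈ T, dist x t ≤ r n) :
    dimH {x | ∃ᶠ n in Filter.atTop, x ∈ E n} ≤ ENNReal.ofReal s := by
  borelize X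
  choose! T hTN hT using hcov
  have hr2 : Filter.Tendsto (fun n => ENNReal.ofReal (2 * r n)) Filter.atTop (nhds 0) := by
    have := ENNReal.tendsto_ofReal (hr.const_mul 2)
    simpa using this
  -- the supremum bounds the diameters of all covering balls of index at least `m`
  have hR : Filter.Tendsto (fun m => ⨆ n ≥ m, ENNReal.ofReal (2 * r n)) Filter.atTop (nhds 0) := by
    rw [ENNReal.tendsto_atTop_zero] at hr2 ⊢
    intro ε hε
    obtain ⟨m, hm⟩ := hr2 ε hε
    exact ⟨m, fun n hn => iSup₂_le fun i hi => hm i (hn.trans hi)⟩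
  have key : μH[s] {x | ∃ᶠ n in Filter.atTop, x ∈ E n} ≤
      Filter.liminf (fun m => ∑' i : (Σ n : ℕ, T (m + n)),
        Metric.ediam (Metric.closedBall (i.2 : X) (r (m + i.1))) ^ s) Filter.atTop := by
    refine Measure.hausdorffMeasure_le_liminf_tsum s _ _ hR
      (fun m (i : (Σ n : ℕ, T (m + n))) => Metric.closedBall (i.2 : X) (r (m + i.1))) ?_ ?_
    · refine Filter.Eventually.of_forall fun m i => ?_
      refine le_trans ?_ (le_iSup₂ (f := fun n (_ : n ≥ m) => ENNReal.ofReal (2 * r n))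
        (m + i.1) (Nat.le_add_right _ _))
      refine Metric.ediam_le_of_forall_dist_le fun x hx y hy => ?_
      have := dist_triangle_right x y (i.2 : X)
      rw [Metric.mem_closedBall] at hx hy
      linarith
    · refine (Filter.eventually_ge_atTop n₀).mono fun m hm x hx => ?_
      obtain ⟨n, hn, hxn⟩ := (Filter.frequently_atTop.1 hx) m
      obtain ⟨t, ht, hxt⟩ := hT n (hm.trans hn) x hxn
      obtain ⟨l, rfl⟩ := Nat.exists_eq_add_of_le hn
      exact Set.mem_iUnion.2 ⟨⟨l, ⟨t, ht⟩⟩, hxt⟩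
  have hbound : ∀ m ≥ n₀, ∑' i : (Σ n : ℕ, T (m + n)),
      Metric.ediam (Metric.closedBall (i.2 : X) (r (m + i.1))) ^ s ≤
        ENNReal.ofReal (A * (1 - q)⁻¹) := by
    intro m hm
    rw [ENNReal.tsum_sigma']
    have hterm : ∀ n, ∑' t : T (m + n),
        Metric.ediam (Metric.closedBall (t : X) (r (m + n))) ^ s ≤
          ENNReal.ofReal (A * q ^ n) := by
      intro n
      have hle : ∀ t : T (m + n), Metric.ediam (Metric.closedBall (t : X) (r (m + n))) ^ s ≤
          ENNReal.ofReal ((2 * r (m + n)) ^ s) := by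
        intro t
        rw [← ENNReal.ofReal_rpow_of_nonneg (by linarith [hr0 (m + n)]) hs.le]
        gcongr
        refine Metric.ediam_le_of_forall_dist_le fun x hx y hy => ?_
        have := dist_triangle_right x y (t : X)
        rw [Metric.mem_closedBall] at hx hy
        linarith
      refine (ENNReal.tsum_le_tsum hle).trans ?_
      rw [tsum_fintype, Finset.sum_const, nsmul_eq_mul, Finset.card_univ, Fintype.card_coe,
        ← ENNReal.ofReal_natCast, ← ENNReal.ofReal_mul (by positivity)]
      apply ENNReal.ofReal_le_ofReal
      calc ((T (m + n)).card : ℝ) * (2 * r (m + n)) ^ s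
          ≤ N (m + n) * (2 * r (m + n)) ^ s := by
            have := hr0 (m + n)
            gcongr
            exact hTN _ (by omega)
        _ ≤ A * q ^ (m + n) := hsum _
        _ ≤ A * q ^ n := by
            gcongr A * ?_
            exact pow_le_pow_of_le_one hq0 hq1.le (by omega)
    refine (ENNReal.tsum_le_tsum hterm).trans ?_
    rw [← ENNReal.ofReal_tsum_of_nonneg (fun n => by positivity)
      ((summable_geometric_of_lt_one hq0 hq1).mul_left A), tsum_mul_left,
      tsum_geometric_of_lt_one hq0 hq1]
  have hfin : μH[s] {x | ∃ᶠ n in Filter.atTop, x ∈ E n} ≠ ⊤ := by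
    refine ne_top_of_le_ne_top (b := ENNReal.ofReal (A * (1 - q)⁻¹)) ENNReal.ofReal_ne_top
      (key.trans ?_)
    refine Filter.liminf_le_of_le (by isBoundedDefault) fun b hb => ?_
    obtain ⟨m, h1, h2⟩ := (hb.and (Filter.eventually_ge_atTop n₀)).exists
    exact h1.trans (hbound m h2)
  have : (s : ℝ) = ((s.toNNReal : NNReal) : ℝ) := (Real.coe_toNNReal s hs.le).symm
  rw [this] at hfin
  exact dimH_le_of_hausdorffMeasure_ne_top hfin

/-! ### Quadratic polynomials and rational points of a quadric -/

section Quadric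

variable {d : ℕ}

/-- The polynomial `e + b · X + X · A X`. -/
noncomputable def quadPoly (e : ℤ) (b : Fin d → ℤ) (A : Matrix (Fin d) (Fin d) ℤ) :
    MvPolynomial (Fin d) ℤ :=
  MvPolynomial.C e + ∑ i, MvPolynomial.C (b i) * MvPolynomial.X i +
    ∑ i, ∑ j, MvPolynomial.C (A i j) * (MvPolynomial.X i * MvPolynomial.X j)

lemma quadPoly_add (e e' : ℤ) (b b' : Fin d → ℤ) (A A' : Matrix (Fin d) (Fin d) ℤ) :
    quadPoly e b A + quadPoly e' b' A' = quadPoly (e + e') (b + b') (A + A') := by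
  simp only [quadPoly, Pi.add_apply, Matrix.add_apply, map_add, add_mul, Finset.sum_add_distrib]
  ring

lemma exists_eq_quadPoly {P : MvPolynomial (Fin d) ℤ} (hP : P.totalDegree ≤ 2) :
    ∃ e b A, P = quadPoly e b A := by
  rw [← P.support_sum_monomial_coeff]
  have hsplit : ∀ m : Fin d →₀ ℕ, m ≠ 0 →
      ∃ i m', m = Finsupp.single i 1 + m' ∧ m.degree = m'.degree + 1 := by
    intro m hm
    obtain ⟨i, hi⟩ := Finsupp.ne_iff.1 hm
    have hle : Finsupp.single i 1 ≤ m := by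
      rw [Finsupp.single_le_iff]
      exact Nat.one_le_iff_ne_zero.2 hi
    refine ⟨i, m - Finsupp.single i 1, (add_tsub_cancel_of_le hle).symm, ?_⟩
    conv_lhs => rw [← add_tsub_cancel_of_le hle, map_add, Finsupp.degree_single]
    omega
  refine Finset.sum_induction _ (fun p => ∃ e b A, p = quadPoly e b A) ?_ ?_ ?_
  · rintro _ _ ⟨e, b, A, rfl⟩ ⟨e', b', A', rfl⟩
    exact ⟨_, _, _, quadPoly_add _ _ _ _ _ _⟩
  · exact ⟨0, 0, 0, by simp [quadPoly]⟩
  · intro m hm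
    have hdeg : m.degree ≤ 2 := (MvPolynomial.le_totalDegree hm).trans hP
    generalize P.coeff m = a
    by_cases h0 : m = 0
    · subst h0
      exact ⟨a, 0, 0, by simp [quadPoly]⟩
    obtain ⟨i, m₁, rfl, h1⟩ := hsplit m h0
    by_cases h0' : m₁ = 0
    · subst h0'
      refine ⟨0, Pi.single i a, 0, ?_⟩
      simp only [quadPoly, map_zero, zero_add, Matrix.zero_apply, zero_mul, Finset.sum_const_zero,
        add_zero]
      rw [Finset.sum_eq_single i]
      · rw [Pi.single_eq_same, MvPolynomial.C_mul_X_eq_monomial]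
      · intro l _ hl
        simp [hl]
      · simp
    obtain ⟨j, m₂, rfl, h2⟩ := hsplit m₁ h0'
    have h3 : m₂ = 0 := by
      rw [← Finsupp.degree_eq_zero_iff]
      omega
    subst h3
    refine ⟨0, 0, Matrix.single i j a, ?_⟩
    simp only [quadPoly, map_zero, Pi.zero_apply, zero_mul, Finset.sum_const_zero, zero_add,
      Matrix.single_apply, add_zero]
    rw [Finset.sum_eq_single i, Finset.sum_eq_single j]
    · rw [if_pos ⟨rfl, rfl⟩, MvPolynomial.X, MvPolynomial.X, MvPolynomial.monomial_mul,
        MvPolynomial.C_mul_monomial, mul_one, mul_one]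
    · intro l _ hl
      simp [hl.symm]
    · simp
    · intro l _ hl
      simp [hl.symm]
    · simp

variable (K : Type*) [Field K]

/-- The bilinear form `u · A v` over `K`. -/
noncomputable def form (A : Matrix (Fin d) (Fin d) ℤ) : LinearMap.BilinForm K (Fin d → K) :=
  Matrix.toBilin' (A.map (Int.cast : ℤ → K))

/-- The gradient of `quadPoly e b A` over `K`. -/
def grad (b : Fin d → ℤ) (A : Matrix (Fin d) (Fin d) ℤ) (x : Fin d → K) : Fin d → K :=
  fun i => (b i : K) + ∑ j, ((A i j : K) + A j i) * x j

variable {K} {e : ℤ} {b : Fin d → ℤ} {A : Matrix (Fin d) (Fin d) ℤ}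

lemma form_apply (u v : Fin d → K) : form K A u v = ∑ i, ∑ j, u i * A i j * v j := by
  simp [form, Matrix.toBilin'_apply]

lemma aeval_quadPoly (x : Fin d → K) :
    MvPolynomial.aeval x (quadPoly e b A) = e + (∑ i, b i * x i) + form K A x x := by
  simp only [quadPoly, map_add, map_sum, map_mul, MvPolynomial.aeval_X, form_apply]
  simp [mul_comm, mul_left_comm, mul_assoc]

lemma grad_dotProduct (x v : Fin d → K) :
    grad K b A x ⬝ᵥ v = (∑ i, b i * v i) + form K A x v + form K A v x := by
  have h : form K A x v = ∑ i, ∑ j, x j * A j i * v i := by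
    rw [form_apply, Finset.sum_comm]
  rw [h, form_apply, dotProduct, ← Finset.sum_add_distrib, ← Finset.sum_add_distrib]
  refine Finset.sum_congr rfl fun i _ => ?_
  rw [grad, add_mul, Finset.sum_mul, add_assoc, ← Finset.sum_add_distrib]
  congr 1
  exact Finset.sum_congr rfl fun j _ => by ring

lemma aeval_pderiv_quadPoly (x : Fin d → K) (i : Fin d) :
    MvPolynomial.aeval x (MvPolynomial.pderiv i (quadPoly e b A)) = grad K b A x i := by
  simp only [quadPoly, map_add, map_sum, Derivation.leibniz, MvPolynomial.pderiv_X,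
    MvPolynomial.pderiv_C, smul_eq_mul, mul_zero, add_zero, zero_add, map_mul,
    MvPolynomial.aeval_X, grad, mul_add, Finset.sum_add_distrib, add_mul, Pi.single_apply]
  simp [apply_ite, add_comm]

/-- The Taylor expansion of a quadratic polynomial. -/
lemma aeval_quadPoly_eq (x y : Fin d → K) :
    MvPolynomial.aeval y (quadPoly e b A) = MvPolynomial.aeval x (quadPoly e b A) +
      grad K b A x ⬝ᵥ (y - x) + form K A (y - x) (y - x) := by
  rw [aeval_quadPoly, aeval_quadPoly, grad_dotProduct]
  simp only [map_sub, LinearMap.sub_apply, Pi.sub_apply, mul_sub, Finset.sum_sub_distrib]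
  ring

lemma form_ratCast (u v : Fin d → ℚ) :
    form ℝ A (fun i => (u i : ℝ)) (fun i => (v i : ℝ)) = (form ℚ A u v : ℚ) := by
  simp [form_apply]

lemma grad_ratCast (x : Fin d → ℚ) :
    grad ℝ b A (fun i => (x i : ℝ)) = fun i => ((grad ℚ b A x i : ℚ) : ℝ) := by
  ext i
  simp [grad]

lemma aeval_ratCast (x : Fin d → ℚ) :
    MvPolynomial.aeval (fun i => (x i : ℝ)) (quadPoly e b A) =
      ((MvPolynomial.aeval x (quadPoly e b A) : ℚ) : ℝ) := by
  rw [aeval_quadPoly, aeval_quadPoly, form_ratCast]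
  simp

/-- For two rational points of the quadric with denominators `q`, `q'`, the value of the quadratic
part at their difference is an integer multiple of `1 / (q q')`. -/
lemma exists_int_form_sub {p p' : Fin d → ℤ} {q q' : ℕ} (hq : 0 < q) (hq' : 0 < q')
    (h : MvPolynomial.aeval (fun i => (p i : ℚ) / q) (quadPoly e b A) = 0)
    (h' : MvPolynomial.aeval (fun i => (p' i : ℚ) / q') (quadPoly e b A) = 0) :
    ∃ n : ℤ, (q : ℚ) * q' * form ℚ A ((fun i => (p i : ℚ) / q) - fun i => (p' i : ℚ) / q')
      ((fun i => (p i : ℚ) / q) - fun i => (p' i : ℚ) / q') = n := by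
  have hq0 : (q : ℚ) ≠ 0 := by positivity
  have hq0' : (q' : ℚ) ≠ 0 := by positivity
  set P : Fin d → ℚ := fun i => p i with hPdef
  set P' : Fin d → ℚ := fun i => p' i with hPdef'
  have hx : (fun i => (p i : ℚ) / q) = (q : ℚ)⁻¹ • P := by
    ext i; simp [hPdef]; ring
  have hx' : (fun i => (p' i : ℚ) / q') = (q' : ℚ)⁻¹ • P' := by
    ext i; simp [hPdef']; ring
  rw [aeval_quadPoly, hx] at h
  rw [aeval_quadPoly, hx'] at h'
  have hb : (q : ℚ) * ∑ i, (b i : ℚ) * ((p i : ℚ) / q) = ∑ i, (b i : ℚ) * p i := by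
    rw [Finset.mul_sum]
    refine Finset.sum_congr rfl fun i _ => ?_
    field_simp
  have hb' : (q' : ℚ) * ∑ i, (b i : ℚ) * ((p' i : ℚ) / q') = ∑ i, (b i : ℚ) * p' i := by
    rw [Finset.mul_sum]
    refine Finset.sum_congr rfl fun i _ => ?_
    field_simp
  have hBi : ∃ m : ℤ, form ℚ A P P' + form ℚ A P' P = m :=
    ⟨(∑ i, ∑ j, p i * A i j * p' j) + ∑ i, ∑ j, p' i * A i j * p j, by
      simp [form_apply, hPdef, hPdef']⟩
  obtain ⟨m, hm⟩ := hBi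
  refine ⟨-2 * e * q * q' - q' * (∑ i, b i * p i) - q * (∑ i, b i * p' i) - m, ?_⟩
  rw [hx, hx']
  push_cast
  rw [← hb, ← hb', ← hm]
  simp only [map_sub, LinearMap.sub_apply, map_smul, LinearMap.smul_apply, smul_eq_mul] at h h' ⊢
  generalize (∑ i, (b i : ℚ) * ((p i : ℚ) / q)) = u at *
  generalize (∑ i, (b i : ℚ) * ((p' i : ℚ) / q')) = u' at *
  have e1 : (q : ℚ)⁻¹ * ((q : ℚ)⁻¹ * form ℚ A P P) = -e - u := by linarith
  have e2 : (q' : ℚ)⁻¹ * ((q' : ℚ)⁻¹ * form ℚ A P' P') = -e - u' := by linarith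
  have e3 : (q : ℚ) * q' * (-e - u) - q * q' * (-(-e - u')) =
      -2 * e * q * q' - q' * (q * u) - q * (q' * u') := by ring
  rw [← e3, ← e1, ← e2]
  field_simp
  ring

/-- A polynomial of degree at most one, written around the point `x₀`. -/
noncomputable def affinePoly (s : ℚ) (l x₀ : Fin d → ℚ) : MvPolynomial (Fin d) ℚ :=
  MvPolynomial.C s + ∑ i, MvPolynomial.C (l i) * (MvPolynomial.X i - MvPolynomial.C (x₀ i))

lemma eval_affinePoly (s : ℚ) (l x₀ x : Fin d → ℚ) :
    MvPolynomial.eval x (affinePoly s l x₀) = s + l ⬝ᵥ (x - x₀) := by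
  simp [affinePoly, dotProduct]

lemma totalDegree_affinePoly_le (s : ℚ) (l x₀ : Fin d → ℚ) :
    (affinePoly s l x₀).totalDegree ≤ 1 := by
  refine (MvPolynomial.totalDegree_add _ _).trans (max_le (by simp) ?_)
  refine MvPolynomial.totalDegree_finsetSum_le fun i _ => ?_
  refine (MvPolynomial.totalDegree_mul _ _).trans ?_
  rw [MvPolynomial.totalDegree_C, zero_add]
  refine (MvPolynomial.totalDegree_sub _ _).trans (max_le ?_ (by simp))
  simp

/-- If the quadratic part vanished on the rational tangent hyperplane at a rational point, then the
polynomial would have the equation of this tangent hyperplane as a factor. -/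
lemma exists_tangent_form_ne_zero (hdeg : (quadPoly e b A).totalDegree = 2)
    (hirr : Irreducible (MvPolynomial.map (Int.castRingHom ℚ) (quadPoly e b A)))
    {x₀ : Fin d → ℚ} (hx₀ : MvPolynomial.aeval x₀ (quadPoly e b A) = 0)
    (hg : grad ℚ b A x₀ ≠ 0) :
    ∃ u : Fin d → ℚ, grad ℚ b A x₀ ⬝ᵥ u = 0 ∧ form ℚ A u u ≠ 0 := by
  by_contra! hcon
  set g := grad ℚ b A x₀ with hgdef
  obtain ⟨i, hi⟩ := Function.ne_iff.1 hg
  rw [Pi.zero_apply] at hi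
  set v₀ : Fin d → ℚ := Pi.single i (g i)⁻¹ with hv₀
  have hgv₀ : g ⬝ᵥ v₀ = 1 := by simp [hv₀, hi]
  set l : Fin d → ℚ := fun j => (form ℚ A v₀ (Pi.single j 1) + form ℚ A (Pi.single j 1) v₀) -
    form ℚ A v₀ v₀ * g j with hl
  have hldot : ∀ v, l ⬝ᵥ v = form ℚ A v₀ v + form ℚ A v v₀ - form ℚ A v₀ v₀ * (g ⬝ᵥ v) := by
    intro v
    have h1 : v = ∑ j, v j • (Pi.single j 1 : Fin d → ℚ) := by
      ext k; simp [Finset.sum_apply, Pi.single_apply]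
    conv_rhs => rw [h1]
    simp only [map_sum, map_smul, LinearMap.sum_apply, LinearMap.smul_apply, smul_eq_mul,
      dotProduct_sum, dotProduct_smul, dotProduct_single_one]
    rw [dotProduct, Finset.mul_sum, ← Finset.sum_add_distrib, ← Finset.sum_sub_distrib]
    exact Finset.sum_congr rfl fun j _ => by simp only [hl]; ring
  -- `v - (g ⬝ᵥ v) • v₀` is orthogonal to `g`, which makes the form divisible by `g ⬝ᵥ v`
  have hfac : MvPolynomial.map (Int.castRingHom ℚ) (quadPoly e b A) =
      affinePoly 0 g x₀ * affinePoly 1 l x₀ := by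
    refine MvPolynomial.funext fun x => ?_
    have h1 : MvPolynomial.eval x (MvPolynomial.map (Int.castRingHom ℚ) (quadPoly e b A)) =
        MvPolynomial.aeval x (quadPoly e b A) := by
      rw [MvPolynomial.eval_map, MvPolynomial.aeval_def]; rfl
    rw [h1, map_mul, eval_affinePoly, eval_affinePoly, aeval_quadPoly_eq x₀ x, hx₀, hldot,
      ← hgdef]
    set v := x - x₀
    set s := g ⬝ᵥ v with hs
    have h2 := hcon (v - s • v₀) (by
      rw [dotProduct_sub, dotProduct_smul, hgv₀, ← hs]; simp)
    simp only [map_sub, LinearMap.sub_apply, map_smul, LinearMap.smul_apply, smul_eq_mul] at h2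
    linear_combination h2
  have hdeg' : (MvPolynomial.map (Int.castRingHom ℚ) (quadPoly e b A)).totalDegree = 2 := by
    rw [← hdeg]
    simp only [MvPolynomial.totalDegree,
      MvPolynomial.support_map_of_injective _ (RingHom.injective_int (Int.castRingHom ℚ))]
  have hle : ∀ p r : MvPolynomial (Fin d) ℚ, IsUnit p → r.totalDegree ≤ 1 →
      (p * r).totalDegree ≤ 1 := by
    intro p r hp hr
    have := (MvPolynomial.isUnit_iff_totalDegree_of_isReduced.1 hp).2
    have := MvPolynomial.totalDegree_mul p r
    omega
  rcases hirr.isUnit_or_isUnit hfac with h | h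
  · have := hle _ (affinePoly 1 l x₀) h (totalDegree_affinePoly_le _ _ _)
    rw [← hfac] at this
    omega
  · have := hle _ (affinePoly 0 g x₀) h (totalDegree_affinePoly_le _ _ _)
    rw [mul_comm, ← hfac] at this
    omega

/-- Vectors tangent to the quadric at `x₀` whose differences are isotropic span a proper subspace
of the tangent hyperplane: they have a common normal `w` in the tangent hyperplane. -/
lemma exists_tangent_normal (hdeg : (quadPoly e b A).totalDegree = 2)
    (hirr : Irreducible (MvPolynomial.map (Int.castRingHom ℚ) (quadPoly e b A)))
    {x₀ : Fin d → ℚ} (hx₀ : MvPolynomial.aeval x₀ (quadPoly e b A) = 0)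
    (hg : grad ℚ b A x₀ ≠ 0) (R : Set (Fin d → ℝ))
    (hR : ∀ v ∈ R, form ℝ A v v = 0) (hRR : ∀ v ∈ R, ∀ v' ∈ R, form ℝ A (v - v') (v - v') = 0)
    (hRg : ∀ v ∈ R, grad ℝ b A (fun i => (x₀ i : ℝ)) ⬝ᵥ v = 0) :
    ∃ w : Fin d → ℝ, w ≠ 0 ∧ (∀ v ∈ R, w ⬝ᵥ v = 0) ∧
      w ⬝ᵥ grad ℝ b A (fun i => (x₀ i : ℝ)) = 0 := by
  set g := grad ℝ b A (fun i => (x₀ i : ℝ)) with hgdef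
  have hpol : ∀ v ∈ R, ∀ v' ∈ R, form ℝ A v v' + form ℝ A v' v = 0 := by
    intro v hv v' hv'
    have := hRR v hv v' hv'
    simp only [map_sub, LinearMap.sub_apply, hR v hv, hR v' hv'] at this
    linarith
  have hpol' : ∀ v ∈ Submodule.span ℝ R, ∀ v' ∈ R, form ℝ A v v' + form ℝ A v' v = 0 := by
    intro v hv v' hv'
    induction hv using Submodule.span_induction with
    | mem v hv => exact hpol v hv v' hv'
    | zero => simp
    | add x y _ _ hx hy => simp only [map_add, LinearMap.add_apply]; linarith
    | smul c x _ hx =>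
      simp only [map_smul, LinearMap.smul_apply, smul_eq_mul]; linear_combination c * hx
  have hpol'' : ∀ v ∈ Submodule.span ℝ R, ∀ v' ∈ Submodule.span ℝ R,
      form ℝ A v v' + form ℝ A v' v = 0 := by
    intro v hv v' hv'
    induction hv' using Submodule.span_induction with
    | mem v' hv' => exact hpol' v hv v' hv'
    | zero => simp
    | add x y _ _ hx hy => simp only [map_add, LinearMap.add_apply]; linarith
    | smul c x _ hx =>
      simp only [map_smul, LinearMap.smul_apply, smul_eq_mul]; linear_combination c * hx
  have hspan : ∀ v ∈ Submodule.span ℝ R, g ⬝ᵥ v = 0 := by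
    intro v hv
    induction hv using Submodule.span_induction with
    | mem v hv => exact hRg v hv
    | zero => simp
    | add x y _ _ hx hy => rw [dotProduct_add, hx, hy, add_zero]
    | smul c x _ hx => rw [dotProduct_smul, hx, smul_zero]
  have hg0 : g ≠ 0 := by
    obtain ⟨i, hi⟩ := Function.ne_iff.1 hg
    refine Function.ne_iff.2 ⟨i, ?_⟩
    rw [hgdef, grad_ratCast]
    simpa using hi
  have hgg : g ⬝ᵥ g ≠ 0 := by simpa [dotProduct_self_eq_zero] using hg0
  have hlt : Submodule.span ℝ R ⊔ Submodule.span ℝ {g} < ⊤ := by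
    rw [lt_top_iff_ne_top]
    intro htop
    obtain ⟨u, hu, hQu⟩ := exists_tangent_form_ne_zero hdeg hirr hx₀ hg
    apply hQu
    have humem : (fun i => (u i : ℝ)) ∈ Submodule.span ℝ R ⊔ Submodule.span ℝ {g} := by
      rw [htop]; trivial
    obtain ⟨v, hv, z, hz, hvz⟩ := Submodule.mem_sup.1 humem
    obtain ⟨c, rfl⟩ := Submodule.mem_span_singleton.1 hz
    have hu' : g ⬝ᵥ (fun i => (u i : ℝ)) = 0 := by
      rw [hgdef, grad_ratCast]
      have : ((grad ℚ b A x₀ ⬝ᵥ u : ℚ) : ℝ) = 0 := by rw [hu]; simp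
      simpa [dotProduct] using this
    rw [← hvz, dotProduct_add, hspan v hv, dotProduct_smul, zero_add, smul_eq_mul] at hu'
    have hc : c = 0 := (mul_eq_zero.1 hu').resolve_right hgg
    rw [hc, zero_smul, add_zero] at hvz
    have h1 := hpol'' v hv v hv
    rw [hvz, form_ratCast] at h1
    have : form ℚ A u u + form ℚ A u u = 0 := by exact_mod_cast h1
    linarith
  obtain ⟨f, hf, hker⟩ := Submodule.exists_le_ker_of_lt_top _ hlt
  have hfdot : ∀ v, (fun i => f (Pi.single i 1)) ⬝ᵥ v = f v := by
    intro v
    have h1 : v = ∑ j, v j • (Pi.single j 1 : Fin d → ℝ) := by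
      ext k; simp [Finset.sum_apply, Pi.single_apply]
    conv_rhs => rw [h1]
    simp [dotProduct, mul_comm]
  refine ⟨fun i => f (Pi.single i 1), ?_, ?_, ?_⟩
  · intro h0
    apply hf
    ext i
    simpa using congrFun h0 i
  · intro v hv
    rw [hfdot]
    exact hker (Submodule.mem_sup_left (Submodule.subset_span hv))
  · rw [hfdot]
    exact hker (Submodule.mem_sup_right (Submodule.mem_span_singleton_self _))

end Quadric

/-! ### Charts of a quadric -/

section Chart

variable {d k : ℕ} {e : ℤ} {b : Fin d → ℤ} {A : Matrix (Fin d) (Fin d) ℤ}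

lemma exists_abs_form_le (A : Matrix (Fin d) (Fin d) ℤ) :
    ∃ C : ℝ, 0 < C ∧ ∀ v : EuclideanSpace ℝ (Fin d),
      |form ℝ A v.ofLp v.ofLp| ≤ C * ‖v‖ ^ 2 := by
  refine ⟨(∑ i, ∑ j, |(A i j : ℝ)|) + 1, by positivity, fun v => ?_⟩
  rw [form_apply]
  have h1 : |∑ i, ∑ j, v.ofLp i * (A i j : ℝ) * v.ofLp j| ≤
      ∑ i, ∑ j, |(A i j : ℝ)| * ‖v‖ ^ 2 := by
    refine (Finset.abs_sum_le_sum_abs _ _).trans (Finset.sum_le_sum fun i _ => ?_)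
    refine (Finset.abs_sum_le_sum_abs _ _).trans (Finset.sum_le_sum fun j _ => ?_)
    rw [abs_mul, abs_mul]
    have hi : |v.ofLp i| ≤ ‖v‖ := PiLp.norm_apply_le v i
    have hj : |v.ofLp j| ≤ ‖v‖ := PiLp.norm_apply_le v j
    calc |v.ofLp i| * |(A i j : ℝ)| * |v.ofLp j| ≤ ‖v‖ * |(A i j : ℝ)| * ‖v‖ := by gcongr
      _ = _ := by ring
  refine h1.trans ?_
  simp_rw [← Finset.sum_mul]
  nlinarith [sq_nonneg ‖v‖]

/-- The gradient of `quadPoly e b A` as a vector of Euclidean space. -/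
noncomputable def gradient (b : Fin d → ℤ) (A : Matrix (Fin d) (Fin d) ℤ)
    (z : EuclideanSpace ℝ (Fin d)) : EuclideanSpace ℝ (Fin d) :=
  WithLp.toLp 2 (grad ℝ b A z.ofLp)

lemma inner_gradient (z v : EuclideanSpace ℝ (Fin d)) :
    inner ℝ (gradient b A z) v = grad ℝ b A z.ofLp ⬝ᵥ v.ofLp := by
  simp [gradient, PiLp.inner_apply, dotProduct, mul_comm]

lemma continuous_gradient : Continuous (gradient b A) := by
  refine (PiLp.continuous_toLp 2 _).comp (continuous_pi fun i => ?_)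
  unfold grad
  fun_prop

lemma hasFDerivAt_aeval (z : EuclideanSpace ℝ (Fin d)) :
    HasFDerivAt (fun y : EuclideanSpace ℝ (Fin d) =>
      MvPolynomial.aeval y.ofLp (quadPoly e b A)) (innerSL ℝ (gradient b A z)) z := by
  obtain ⟨C, hC, hform⟩ := exists_abs_form_le A
  have h1 : HasFDerivAt (fun y : EuclideanSpace ℝ (Fin d) =>
      form ℝ A (y - z).ofLp (y - z).ofLp) (0 : EuclideanSpace ℝ (Fin d) →L[ℝ] ℝ) z := by
    refine Asymptotics.IsBigO.hasFDerivAt (n := 2) ?_ one_lt_two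
    refine Asymptotics.IsBigO.of_bound C (Filter.Eventually.of_forall fun y => ?_)
    rw [Real.norm_eq_abs, Real.norm_of_nonneg (by positivity)]
    exact hform _
  have h2 : HasFDerivAt (fun y : EuclideanSpace ℝ (Fin d) =>
      innerSL ℝ (gradient b A z) (y - z)) (innerSL ℝ (gradient b A z)) z :=
    (innerSL ℝ (gradient b A z)).hasFDerivAt.comp z ((hasFDerivAt_id z).sub_const z)
  have h3 := (h2.const_add (MvPolynomial.aeval z.ofLp (quadPoly e b A))).add h1
  rw [add_zero] at h3
  refine h3.congr_of_eventuallyEq (Filter.Eventually.of_forall fun y => ?_)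
  change _ = MvPolynomial.aeval z.ofLp (quadPoly e b A) + inner ℝ (gradient b A z) (y - z) +
    form ℝ A (y - z).ofLp (y - z).ofLp
  rw [inner_gradient]
  exact aeval_quadPoly_eq z.ofLp y.ofLp

lemma gradient_ne_zero {z : EuclideanSpace ℝ (Fin d)} (hz : z ∈ regularPart (quadPoly e b A)) :
    gradient b A z ≠ 0 := by
  obtain ⟨-, i, hi⟩ := hz
  intro h0
  apply hi
  rw [aeval_pderiv_quadPoly]
  simpa [gradient] using congrArg (fun v : EuclideanSpace ℝ (Fin d) => v.ofLp i) h0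

variable {U : Set (EuclideanSpace ℝ (Fin k))}
  {Ψ : EuclideanSpace ℝ (Fin k) → EuclideanSpace ℝ (Fin d)}

lemma IsLocalChart.mem_of_mem {M : Set (EuclideanSpace ℝ (Fin d))} {n : WithTop ℕ∞}
    (hΨ : IsLocalChart n U Ψ M) {y : EuclideanSpace ℝ (Fin k)} (hy : y ∈ U) : Ψ y ∈ M := by
  obtain ⟨V, -, hV⟩ := hΨ.isOpen_image
  have : Ψ y ∈ V ∩ M := hV ▸ Set.mem_image_of_mem Ψ hy
  exact this.2

lemma IsLocalChart.contDiffAt {M : Set (EuclideanSpace ℝ (Fin d))} {n : WithTop ℕ∞}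
    (hΨ : IsLocalChart n U Ψ M) {y : EuclideanSpace ℝ (Fin k)} (hy : y ∈ U) :
    ContDiffAt ℝ n Ψ y :=
  hΨ.contDiffOn.contDiffAt (hΨ.isOpen_source.mem_nhds hy)

lemma IsLocalChart.inner_gradient_fderiv (hΨ : IsLocalChart 2 U Ψ (regularPart (quadPoly e b A)))
    {y : EuclideanSpace ℝ (Fin k)} (hy : y ∈ U) (v : EuclideanSpace ℝ (Fin k)) :
    inner ℝ (gradient b A (Ψ y)) (fderiv ℝ Ψ y v) = 0 := by
  have h1 := ((hΨ.contDiffAt hy).differentiableAt (by norm_num)).hasFDerivAt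
  have h2 := (hasFDerivAt_aeval (e := e) (b := b) (A := A) (Ψ y)).comp y h1
  have h3 : HasFDerivAt ((fun y : EuclideanSpace ℝ (Fin d) =>
      MvPolynomial.aeval y.ofLp (quadPoly e b A)) ∘ Ψ)
      (0 : EuclideanSpace ℝ (Fin k) →L[ℝ] ℝ) y := by
    refine (hasFDerivAt_const (0 : ℝ) y).congr_of_eventuallyEq ?_
    filter_upwards [hΨ.isOpen_source.mem_nhds hy] with x hx
    exact (hΨ.mem_of_mem hx).1
  have h4 := congrArg (fun L : EuclideanSpace ℝ (Fin k) →L[ℝ] ℝ => L v) (h2.unique h3)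
  simpa using h4

/-- The differential of a chart of a hypersurface together with the normal vector spans the ambient
space, so that a vector orthogonal to the normal and to the image of the differential is zero. -/
lemma IsLocalChart.eq_zero_of_adjoint (hk : k + 1 = d)
    (hΨ : IsLocalChart 2 U Ψ (regularPart (quadPoly e b A)))
    {y : EuclideanSpace ℝ (Fin k)} (hy : y ∈ U) {w : EuclideanSpace ℝ (Fin d)}
    (h1 : (fderiv ℝ Ψ y).adjoint w = 0) (h2 : inner ℝ (gradient b A (Ψ y)) w = 0) : w = 0 := by
  set g := gradient b A (Ψ y) with hg
  have hg0 : g ≠ 0 := gradient_ne_zero (hΨ.mem_of_mem hy)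
  let F : (EuclideanSpace ℝ (Fin k) × ℝ) →ₗ[ℝ] EuclideanSpace ℝ (Fin d) :=
    (fderiv ℝ Ψ y : EuclideanSpace ℝ (Fin k) →ₗ[ℝ] EuclideanSpace ℝ (Fin d)).coprod
      (LinearMap.toSpanSingleton ℝ _ g)
  have hF : ∀ v t, F (v, t) = fderiv ℝ Ψ y v + t • g := fun v t => by simp [F]
  have hinj : Function.Injective F := by
    rw [injective_iff_map_eq_zero]
    rintro ⟨v, t⟩ hvt
    rw [hF] at hvt
    have h3 := congrArg (inner ℝ g) hvt
    rw [inner_add_right, hΨ.inner_gradient_fderiv hy, inner_smul_right, inner_zero_right,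
      zero_add, real_inner_self_eq_norm_sq] at h3
    have ht : t = 0 := by
      have : ‖g‖ ≠ 0 := norm_ne_zero_iff.2 hg0
      simpa [this] using h3
    subst ht
    rw [zero_smul, add_zero] at hvt
    have hv : v = 0 := hΨ.injective_fderiv y hy (by rw [hvt, map_zero])
    rw [hv]
    rfl
  have hsurj : Function.Surjective F :=
    (LinearMap.injective_iff_surjective_of_finrank_eq_finrank (by simp [hk])).1 hinj
  obtain ⟨⟨v, t⟩, hvt⟩ := hsurj w
  rw [hF] at hvt
  have h3 : inner ℝ w w = 0 := by
    have h4 : inner ℝ w w = inner ℝ (fderiv ℝ Ψ y v + t • g) w := by rw [hvt]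
    rw [h4, inner_add_left, inner_smul_left, h2, mul_zero, add_zero,
      ← ContinuousLinearMap.adjoint_inner_right, h1, inner_zero_right]
  exact inner_self_eq_zero.1 h3

/-- Uniform local estimates for a chart of the quadric. The last one says that the function
`⟨w, Ψ ·⟩` has no critical point when `w` is tangent to the quadric at a nearby point `z`. -/
lemma IsLocalChart.exists_local_bounds (hk : k + 1 = d)
    (hΨ : IsLocalChart 2 U Ψ (regularPart (quadPoly e b A)))
    {y₀ : EuclideanSpace ℝ (Fin k)} (hy₀ : y₀ ∈ U) :
    ∃ η M c₀ : ℝ, 0 < η ∧ 0 < M ∧ 0 < c₀ ∧ Metric.ball y₀ η ⊆ U ∧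
      (∀ x ∈ Metric.ball y₀ η, ∀ y ∈ Metric.ball y₀ η, dist (Ψ x) (Ψ y) ≤ M * dist x y) ∧
      (∀ x ∈ Metric.ball y₀ η, ∀ y ∈ Metric.ball y₀ η,
        ‖Ψ y - Ψ x - fderiv ℝ Ψ x (y - x)‖ ≤ M * dist y x ^ 2) ∧
      ∀ z ∈ Metric.ball (Ψ y₀) η, gradient b A z ≠ 0 ∧
        ∀ x ∈ Metric.ball y₀ η, ∀ w, inner ℝ (gradient b A z) w = 0 →
          c₀ * ‖w‖ ≤ ‖(fderiv ℝ Ψ x).adjoint w‖ := by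
  have hC2 := hΨ.contDiffAt hy₀
  have hC1 : ContDiffAt ℝ 1 (fderiv ℝ Ψ) y₀ := hC2.fderiv_right (by norm_num)
  obtain ⟨K₁, t₁, ht₁, hK₁⟩ :=
    (hC2.of_le (by norm_num : (1 : WithTop ℕ∞) ≤ 2)).exists_lipschitzOnWith
  obtain ⟨K₂, t₂, ht₂, hK₂⟩ := hC1.exists_lipschitzOnWith
  -- `L` is injective, hence bounded below; this lower bound survives a small perturbation of `y₀`
  -- and of `Ψ y₀`
  let L : EuclideanSpace ℝ (Fin d) →L[ℝ] EuclideanSpace ℝ (Fin k) × ℝ :=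
    (fderiv ℝ Ψ y₀).adjoint.prod (innerSL ℝ (gradient b A (Ψ y₀)))
  have hL :
      LinearMap.ker (L : EuclideanSpace ℝ (Fin d) →ₗ[ℝ] EuclideanSpace ℝ (Fin k) × ℝ) = ⊥ := by
    rw [LinearMap.ker_eq_bot']
    intro w hw
    have hw' : ((fderiv ℝ Ψ y₀).adjoint w, inner ℝ (gradient b A (Ψ y₀)) w) = (0 : _ × ℝ) := hw
    rw [Prod.mk_eq_zero] at hw'
    exact hΨ.eq_zero_of_adjoint hk hy₀ hw'.1 hw'.2
  obtain ⟨K, hK0, hK⟩ := LinearMap.exists_antilipschitzWith _ hL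
  have hK0' : (0 : ℝ) < K := by exact_mod_cast hK0
  have hKw : ∀ w, ‖w‖ ≤ K * max ‖(fderiv ℝ Ψ y₀).adjoint w‖ |inner ℝ (gradient b A (Ψ y₀)) w| := by
    intro w
    have := hK.le_mul_dist w 0
    rw [map_zero, dist_zero_right, dist_zero_right] at this
    exact this
  have hnx : ∀ᶠ x in nhds y₀, x ∈ U ∧ x ∈ t₁ ∧ x ∈ t₂ ∧
      dist (fderiv ℝ Ψ x) (fderiv ℝ Ψ y₀) < 1 / (2 * K) := by
    filter_upwards [hΨ.isOpen_source.mem_nhds hy₀, ht₁, ht₂,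
      Metric.tendsto_nhds.1 hC1.continuousAt (1 / (2 * K)) (by positivity)] with x h1 h2 h3 h4
    exact ⟨h1, h2, h3, h4⟩
  have hnz : ∀ᶠ z in nhds (Ψ y₀), gradient b A z ≠ 0 ∧
      dist (gradient b A z) (gradient b A (Ψ y₀)) < 1 / (2 * K) := by
    have hc : ContinuousAt (gradient b A) (Ψ y₀) := continuous_gradient.continuousAt
    exact (hc.eventually_ne (gradient_ne_zero (hΨ.mem_of_mem hy₀))).and
      (Metric.tendsto_nhds.1 hc (1 / (2 * K)) (by positivity))
  obtain ⟨η₁, hη₁, h₁⟩ := Metric.eventually_nhds_iff_ball.1 hnx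
  obtain ⟨η₂, hη₂, h₂⟩ := Metric.eventually_nhds_iff_ball.1 hnz
  have hsub : Metric.ball y₀ (min η₁ η₂) ⊆ Metric.ball y₀ η₁ :=
    Metric.ball_subset_ball (min_le_left _ _)
  refine ⟨min η₁ η₂, K₁ + K₂ + 1, 1 / (2 * K), lt_min hη₁ hη₂, by positivity, by positivity,
    fun x hx => (h₁ x (hsub hx)).1, ?_, ?_, ?_⟩
  · intro x hx y hy
    refine (hK₁.dist_le_mul x (h₁ x (hsub hx)).2.1 y (h₁ y (hsub hy)).2.1).trans ?_
    have : (0 : ℝ) ≤ K₂ := K₂.2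
    gcongr
    linarith
  · intro x hx y hy
    have hseg : segment ℝ x y ⊆ Metric.ball y₀ η₁ :=
      (convex_ball y₀ η₁).segment_subset (hsub hx) (hsub hy)
    have h3 := (convex_segment (𝕜 := ℝ) x y).norm_image_sub_le_of_norm_fderiv_le'
      (f := Ψ) (φ := fderiv ℝ Ψ x) (C := K₂ * dist y x)
      (fun z hz => (hΨ.contDiffAt (h₁ z (hseg hz)).1).differentiableAt (by norm_num))
      (fun z hz => by
        rw [← dist_eq_norm]
        refine (hK₂.dist_le_mul z (h₁ z (hseg hz)).2.2.1 x (h₁ x (hsub hx)).2.2.1).trans ?_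
        have : dist z x ≤ dist y x := by
          rw [dist_eq_norm, dist_eq_norm]
          exact norm_sub_le_of_mem_segment hz
        gcongr)
      (left_mem_segment ℝ x y) (right_mem_segment ℝ x y)
    refine h3.trans ?_
    rw [← dist_eq_norm, mul_assoc, ← sq]
    have : (0 : ℝ) ≤ K₁ := K₁.2
    gcongr
    linarith
  · intro z hz
    obtain ⟨hz0, hzd⟩ := h₂ z (Metric.ball_subset_ball (min_le_right _ _) hz)
    refine ⟨hz0, fun x hx w hw => ?_⟩
    have hxd := (h₁ x (hsub hx)).2.2.2
    have e1 : ‖(fderiv ℝ Ψ y₀).adjoint w‖ ≤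
        ‖(fderiv ℝ Ψ x).adjoint w‖ + 1 / (2 * K) * ‖w‖ := by
      have h3 : (fderiv ℝ Ψ y₀).adjoint w =
          (fderiv ℝ Ψ x).adjoint w - (fderiv ℝ Ψ x - fderiv ℝ Ψ y₀).adjoint w := by
        simp
      rw [h3]
      refine (norm_sub_le _ _).trans ?_
      gcongr
      refine (ContinuousLinearMap.le_opNorm _ _).trans ?_
      rw [LinearIsometryEquiv.norm_map, ← dist_eq_norm]
      gcongr
    have e2 : |inner ℝ (gradient b A (Ψ y₀)) w| ≤ 1 / (2 * K) * ‖w‖ := by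
      have h3 : inner ℝ (gradient b A (Ψ y₀)) w =
          - inner ℝ (gradient b A z - gradient b A (Ψ y₀)) w := by
        rw [inner_sub_left, hw]; ring
      rw [h3, abs_neg]
      refine (abs_real_inner_le_norm _ _).trans ?_
      rw [← dist_eq_norm]
      gcongr
    have e3 := hKw w
    have e4 : max ‖(fderiv ℝ Ψ y₀).adjoint w‖ |inner ℝ (gradient b A (Ψ y₀)) w| ≤
        ‖(fderiv ℝ Ψ x).adjoint w‖ + 1 / (2 * K) * ‖w‖ :=
      max_le e1 (e2.trans (le_add_of_nonneg_left (norm_nonneg _)))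
    have e5 : ‖w‖ ≤ K * (‖(fderiv ℝ Ψ x).adjoint w‖ + 1 / (2 * K) * ‖w‖) :=
      e3.trans (by gcongr)
    have e6 : (K : ℝ) * (1 / (2 * K) * ‖w‖) = ‖w‖ / 2 := by field_simp
    rw [mul_add, e6] at e5
    rw [div_mul_eq_mul_div, one_mul, div_le_iff₀ (by positivity)]
    linarith

end Chart

/-! ### Supports of push-forwards -/

section Support

variable {k d : ℕ} {μ : Measure (EuclideanSpace ℝ (Fin k))} {U : Set (EuclideanSpace ℝ (Fin k))}
  {Ψ : EuclideanSpace ℝ (Fin k) → EuclideanSpace ℝ (Fin d)}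

lemma measure_compl_of_support_subset (hU : μ.support ⊆ U) : μ Uᶜ = 0 :=
  measure_mono_null (Set.compl_subset_compl.2 hU) Measure.measure_compl_support

/-- The values of `Ψ` outside `U` do not matter, as `U` has full measure. -/
lemma aemeasurable_of_continuousOn (hUo : IsOpen U) (hU : μ.support ⊆ U) (hΨ : ContinuousOn Ψ U) :
    AEMeasurable Ψ μ := by
  have h1 := hΨ.aemeasurable (μ := μ) hUo.measurableSet
  rwa [Measure.restrict_eq_self_of_ae_mem] at h1
  rw [ae_iff]
  exact measure_compl_of_support_subset hU

lemma mem_support_of_mem_support_map (hUo : IsOpen U) (hU : μ.support ⊆ U)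
    (hΨ : ContinuousOn Ψ U) (hemb : Topology.IsEmbedding (fun x : U => Ψ x))
    {y : EuclideanSpace ℝ (Fin k)} (hy : y ∈ U) (hsupp : Ψ y ∈ (μ.map Ψ).support) :
    y ∈ μ.support := by
  rw [Measure.mem_support_iff_forall] at hsupp ⊢
  intro W hW
  obtain ⟨O, hO, hOW⟩ : ∃ O ∈ nhds (Ψ y), (fun x : U => Ψ x) ⁻¹' O ⊆ Subtype.val ⁻¹' W := by
    have h1 : (Subtype.val ⁻¹' W : Set U) ∈ nhds (⟨y, hy⟩ : U) :=
      continuous_subtype_val.continuousAt hW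
    rw [hemb.nhds_eq_comap] at h1
    exact Filter.mem_comap.1 h1
  obtain ⟨O', hO'O, hO', hyO'⟩ := mem_nhds_iff.1 hO
  have h2 := hsupp O' (hO'.mem_nhds hyO')
  rw [Measure.map_apply_of_aemeasurable (aemeasurable_of_continuousOn hUo hU hΨ)
    hO'.measurableSet] at h2
  refine h2.trans_le ?_
  calc μ (Ψ ⁻¹' O') ≤ μ (W ∪ Uᶜ) := measure_mono fun x hx => by
        by_cases hxU : x ∈ U
        · exact Or.inl (hOW (a := ⟨x, hxU⟩) (hO'O hx))
        · exact Or.inr hxU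
    _ ≤ μ W + μ Uᶜ := measure_union_le _ _
    _ = μ W := by rw [measure_compl_of_support_subset hU, add_zero]

lemma support_map_subset_of_isCompact (hUo : IsOpen U) (hU : μ.support ⊆ U)
    (hΨ : ContinuousOn Ψ U) (hc : IsCompact μ.support) :
    (μ.map Ψ).support ⊆ Ψ '' μ.support := by
  have hclosed : IsClosed (Ψ '' μ.support) := (hc.image_of_continuousOn (hΨ.mono hU)).isClosed
  refine Measure.support_subset_of_isClosed hclosed ?_
  rw [mem_ae_iff, Measure.map_apply_of_aemeasurable (aemeasurable_of_continuousOn hUo hU hΨ)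
    hclosed.measurableSet.compl]
  refine measure_mono_null (t := μ.supportᶜ) ?_ Measure.measure_compl_support
  exact fun x hx hxs => hx (Set.mem_image_of_mem Ψ hxs)

end Support

/-! ### Rational points close to each other and to a given point -/

section Approximation

variable {d : ℕ} {e : ℤ} {b : Fin d → ℤ} {A : Matrix (Fin d) (Fin d) ℤ}

/-- The point `p / q` of Euclidean space. -/
noncomputable def ratPoint (r : (Fin d → ℤ) × ℕ) : EuclideanSpace ℝ (Fin d) :=
  WithLp.toLp 2 fun i => (r.1 i : ℝ) / (r.2 : ℝ)

lemma ofLp_ratPoint (r : (Fin d → ℤ) × ℕ) :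
    (ratPoint r).ofLp = fun i => (((r.1 i : ℚ) / (r.2 : ℚ) : ℚ) : ℝ) := by
  ext i
  simp [ratPoint]

lemma aeval_ratPoint {r : (Fin d → ℤ) × ℕ} (hr : r ∈ rationalPoints (quadPoly e b A)) :
    MvPolynomial.aeval (ratPoint r).ofLp (quadPoly e b A) = 0 := by
  rw [ofLp_ratPoint, aeval_ratCast, hr.2.2, Rat.cast_zero]

/-- The quadratic part vanishes at the difference of two rational points of the quadric which are
closer to each other than their denominators allow for a nonzero value. -/
lemma form_ratPoint_sub_eq_zero {C θ : ℝ} (hC : 0 < C)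
    (hform : ∀ v : EuclideanSpace ℝ (Fin d), |form ℝ A v.ofLp v.ofLp| ≤ C * ‖v‖ ^ 2)
    (hθ : C * θ ^ 2 * 4 < 1) {n : ℕ} {r r' : (Fin d → ℤ) × ℕ}
    (hr : r ∈ rationalPoints (quadPoly e b A)) (hr' : r' ∈ rationalPoints (quadPoly e b A))
    (hq : r.2 < 2 ^ (n + 1)) (hq' : r'.2 < 2 ^ (n + 1))
    (hdist : dist (ratPoint r) (ratPoint r') ≤ θ / 2 ^ n) :
    form ℝ A (ratPoint r - ratPoint r').ofLp (ratPoint r - ratPoint r').ofLp = 0 := by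
  obtain ⟨m, hm⟩ := exists_int_form_sub hr.1 hr'.1 hr.2.2 hr'.2.2
  have hq0 : (0 : ℝ) < r.2 := by exact_mod_cast hr.1
  have hq0' : (0 : ℝ) < r'.2 := by exact_mod_cast hr'.1
  set F := form ℝ A (ratPoint r - ratPoint r').ofLp (ratPoint r - ratPoint r').ofLp with hF
  have hFm : (r.2 : ℝ) * r'.2 * F = m := by
    have h1 : (ratPoint r - ratPoint r').ofLp = fun i =>
        ((((fun i => (r.1 i : ℚ) / (r.2 : ℚ)) - fun i => (r'.1 i : ℚ) / (r'.2 : ℚ)) i : ℚ) : ℝ) := by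
      ext i
      simp [ratPoint]
    rw [hF, h1, form_ratCast]
    exact_mod_cast congrArg (fun t : ℚ => (t : ℝ)) hm
  have hFle : |F| ≤ C * (θ / 2 ^ n) ^ 2 := by
    refine (hform _).trans ?_
    rw [← dist_eq_norm]
    gcongr
  have hlt : |(m : ℝ)| < 1 := by
    rw [← hFm, abs_mul, abs_of_pos (by positivity)]
    have h1 : (r.2 : ℝ) ≤ 2 ^ (n + 1) := by exact_mod_cast hq.le
    have h2 : (r'.2 : ℝ) ≤ 2 ^ (n + 1) := by exact_mod_cast hq'.le
    calc (r.2 : ℝ) * r'.2 * |F| ≤ 2 ^ (n + 1) * 2 ^ (n + 1) * (C * (θ / 2 ^ n) ^ 2) := by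
          gcongr
      _ = C * θ ^ 2 * 4 := by
          field_simp
          ring
      _ < 1 := hθ
  have hm0 : m = 0 := by
    have : |m| < 1 := by exact_mod_cast hlt
    exact Int.abs_lt_one_iff.1 this
  rw [hm0, Int.cast_zero] at hFm
  exact (mul_eq_zero.1 hFm).resolve_left (by positivity)

lemma grad_dotProduct_ratPoint_sub {r r' : (Fin d → ℤ) × ℕ}
    (hr : r ∈ rationalPoints (quadPoly e b A)) (hr' : r' ∈ rationalPoints (quadPoly e b A))
    (h : form ℝ A (ratPoint r - ratPoint r').ofLp (ratPoint r - ratPoint r').ofLp = 0) :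
    grad ℝ b A (ratPoint r').ofLp ⬝ᵥ (ratPoint r - ratPoint r').ofLp = 0 := by
  have h1 := aeval_quadPoly_eq (e := e) (b := b) (A := A) (ratPoint r').ofLp (ratPoint r).ofLp
  rw [aeval_ratPoint hr, aeval_ratPoint hr', zero_add, ← WithLp.ofLp_sub, h, add_zero] at h1
  exact h1.symm

/-- Rational points of the quadric with denominators below `2 ^ (n + 1)` which are at mutual distance
at most `θ / 2 ^ n`, for a small `θ`, lie in a hyperplane whose normal is tangent to the quadric
at one of them. -/
lemma exists_unit_normal (hdeg : (quadPoly e b A).totalDegree = 2)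
    (hirr : Irreducible (MvPolynomial.map (Int.castRingHom ℚ) (quadPoly e b A)))
    {C θ : ℝ} (hC : 0 < C)
    (hform : ∀ v : EuclideanSpace ℝ (Fin d), |form ℝ A v.ofLp v.ofLp| ≤ C * ‖v‖ ^ 2)
    (hθ : C * θ ^ 2 * 4 < 1) {n : ℕ} {R : Set ((Fin d → ℤ) × ℕ)}
    (hR : R ⊆ rationalPoints (quadPoly e b A)) (hq : ∀ r ∈ R, r.2 < 2 ^ (n + 1))
    (hdist : ∀ r ∈ R, ∀ r' ∈ R, dist (ratPoint r) (ratPoint r') ≤ θ / 2 ^ n)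
    {r₀ : (Fin d → ℤ) × ℕ} (hr₀ : r₀ ∈ R) (hg : gradient b A (ratPoint r₀) ≠ 0) :
    ∃ w : EuclideanSpace ℝ (Fin d), ‖w‖ = 1 ∧ inner ℝ (gradient b A (ratPoint r₀)) w = 0 ∧
      ∀ r ∈ R, inner ℝ w (ratPoint r - ratPoint r₀) = 0 := by
  have hzero : ∀ r ∈ R, ∀ r' ∈ R,
      form ℝ A (ratPoint r - ratPoint r').ofLp (ratPoint r - ratPoint r').ofLp = 0 :=
    fun r hr r' hr' => form_ratPoint_sub_eq_zero hC hform hθ (hR hr) (hR hr') (hq r hr) (hq r' hr')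
      (hdist r hr r' hr')
  have hgrad : grad ℝ b A (fun i => (((r₀.1 i : ℚ) / (r₀.2 : ℚ) : ℚ) : ℝ)) =
      (gradient b A (ratPoint r₀)).ofLp := by
    rw [← ofLp_ratPoint]
    rfl
  obtain ⟨w, hw0, hwR, hwg⟩ := exists_tangent_normal hdeg hirr
    (x₀ := fun i => (r₀.1 i : ℚ) / (r₀.2 : ℚ)) (hR hr₀).2.2
    (by
      intro h0
      apply hg
      rw [gradient, ofLp_ratPoint, grad_ratCast, h0]
      ext i
      simp)
    ((fun r => (ratPoint r - ratPoint r₀).ofLp) '' R)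
    (by
      rintro _ ⟨r, hr, rfl⟩
      exact hzero r hr r₀ hr₀)
    (by
      rintro _ ⟨r, hr, rfl⟩ _ ⟨r', hr', rfl⟩
      have h1 : (ratPoint r - ratPoint r₀).ofLp - (ratPoint r' - ratPoint r₀).ofLp =
          (ratPoint r - ratPoint r').ofLp := by
        rw [← WithLp.ofLp_sub, sub_sub_sub_cancel_right]
      simpa only [h1] using hzero r hr r' hr')
    (by
      rintro _ ⟨r, hr, rfl⟩
      rw [← ofLp_ratPoint]
      exact grad_dotProduct_ratPoint_sub (hR hr) (hR hr₀) (hzero r hr r₀ hr₀))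
  have hinner : ∀ v : EuclideanSpace ℝ (Fin d), inner ℝ (WithLp.toLp 2 w) v = w ⬝ᵥ v.ofLp := by
    intro v
    simp [PiLp.inner_apply, dotProduct, mul_comm]
  have hw1 : (WithLp.toLp 2 w : EuclideanSpace ℝ (Fin d)) ≠ 0 := by
    intro h0
    apply hw0
    simpa using congrArg WithLp.ofLp h0
  have hw2 : ‖(WithLp.toLp 2 w : EuclideanSpace ℝ (Fin d))‖ ≠ 0 := norm_ne_zero_iff.2 hw1
  refine ⟨‖(WithLp.toLp 2 w : EuclideanSpace ℝ (Fin d))‖⁻¹ • WithLp.toLp 2 w, ?_, ?_, ?_⟩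
  · rw [norm_smul, norm_inv, norm_norm, inv_mul_cancel₀ hw2]
  · rw [inner_smul_right, real_inner_comm, hinner, ← hgrad, hwg, mul_zero]
  · intro r hr
    rw [inner_smul_left, hinner, hwR _ ⟨r, hr, rfl⟩, mul_zero]

lemma dist_ratPoint_le (x : EuclideanSpace ℝ (Fin d)) (r : (Fin d → ℤ) × ℕ) {t : ℝ}
    (ht : ∀ i, |x i - (r.1 i : ℝ) / (r.2 : ℝ)| ≤ t) (ht0 : 0 ≤ t) :
    dist x (ratPoint r) ≤ d * t := by
  rw [EuclideanSpace.dist_eq]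
  refine Real.sqrt_le_iff.2 ⟨by positivity, ?_⟩
  calc ∑ i, dist (x.ofLp i) ((ratPoint r).ofLp i) ^ 2 ≤ ∑ _i : Fin d, t ^ 2 := by
        refine Finset.sum_le_sum fun i _ => ?_
        have := ht i
        gcongr
        rw [Real.dist_eq]
        exact this
    _ = d * t ^ 2 := by simp
    _ ≤ (d * t) ^ 2 := by
        rw [mul_pow]
        gcongr
        exact_mod_cast Nat.le_self_pow two_ne_zero d

/-- Only finitely many rational points of bounded denominator lie in a bounded region. -/
lemma finite_ratPoints_of_le (x : EuclideanSpace ℝ (Fin d)) (Q : ℕ) (t : ℝ) :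
    {r : (Fin d → ℤ) × ℕ | 0 < r.2 ∧ r.2 ≤ Q ∧
      ∀ i, |x i - (r.1 i : ℝ) / (r.2 : ℝ)| ≤ t}.Finite := by
  refine Set.Finite.subset (s := Set.Icc (fun i => -⌈Q * (|x i| + t)⌉)
    (fun i => ⌈Q * (|x i| + t)⌉) ×ˢ Set.Iic Q) ((Set.finite_Icc _ _).prod (Set.finite_Iic _)) ?_
  rintro ⟨p, q⟩ ⟨hq0, hqQ, h⟩
  simp only at hq0 hqQ h
  have hq : (0 : ℝ) < q := by exact_mod_cast hq0
  have hb : ∀ i, |(p i : ℝ)| ≤ Q * (|x i| + t) := by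
    intro i
    have h1 : |(p i : ℝ) / q| ≤ |x i| + t := by
      have h2 : (p i : ℝ) / q = x i - (x i - p i / q) := by ring
      rw [h2]
      exact (abs_sub _ _).trans (by linarith [h i])
    rw [abs_div, abs_of_pos hq, div_le_iff₀ hq, mul_comm] at h1
    have h3 : 0 ≤ |x i| + t := add_nonneg (abs_nonneg _) ((abs_nonneg _).trans (h i))
    have h4 : (q : ℝ) ≤ Q := by exact_mod_cast hqQ
    exact h1.trans (by gcongr)
  refine ⟨⟨fun i => ?_, fun i => ?_⟩, hqQ⟩
  · have h1 := (abs_le.1 (hb i)).1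
    have h2 := Int.le_ceil ((Q : ℝ) * (|x i| + t))
    have h3 : (-⌈(Q : ℝ) * (|x i| + t)⌉ : ℝ) ≤ p i := by linarith
    exact_mod_cast h3
  · have h1 := (abs_le.1 (hb i)).2
    have h2 := Int.le_ceil ((Q : ℝ) * (|x i| + t))
    have h3 : (p i : ℝ) ≤ ⌈(Q : ℝ) * (|x i| + t)⌉ := by linarith
    exact_mod_cast h3

/-- A point of exponent greater than `c` has, for infinitely many `n`, a rational approximation with
denominator in `[2 ^ n, 2 ^ (n + 1))` and error at most `κ 2 ^ (-n c)`; the strict inequality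
absorbs all constants. -/
lemma frequently_exists_close {P : MvPolynomial (Fin d) ℤ} {x : EuclideanSpace ℝ (Fin d)} {c κ : ℝ}
    (hc : 0 ≤ c) (hκ : 0 < κ) (hx : (c : EReal) < intrinsicExponent P x) :
    ∃ᶠ n : ℕ in Filter.atTop, ∃ r ∈ rationalPoints P, 2 ^ n ≤ r.2 ∧ r.2 < 2 ^ (n + 1) ∧
      dist x (ratPoint r) ≤ κ / ((2 : ℝ) ^ c) ^ n := by
  obtain ⟨_, ⟨c', ⟨hc', C, hinf⟩, rfl⟩, hcc'⟩ := lt_sSup_iff.1 hx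
  replace hcc' : c < c' := EReal.coe_lt_coe_iff.1 hcc'
  rw [Filter.frequently_atTop]
  intro N
  have hlim : Filter.Tendsto (fun q : ℕ => d * |C| / (q : ℝ) ^ (c' - c)) Filter.atTop (nhds 0) :=
    ((tendsto_rpow_atTop (sub_pos.2 hcc')).comp tendsto_natCast_atTop_atTop).const_div_atTop _
  obtain ⟨Q, hQ⟩ := Filter.eventually_atTop.1 (hlim.eventually_le_const hκ)
  obtain ⟨r, ⟨hrP, hr⟩, hrQ⟩ := (hinf.sdiff
    (finite_ratPoints_of_le x (max Q (2 ^ N)) |C|)).nonempty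
  have hq1 : (1 : ℝ) ≤ r.2 := by exact_mod_cast hrP.1
  have hq0 : (0 : ℝ) < r.2 := by linarith
  have hle : ∀ i, |x i - (r.1 i : ℝ) / (r.2 : ℝ)| ≤ |C| / (r.2 : ℝ) ^ c' := fun i =>
    (hr i).trans (by gcongr; exact le_abs_self C)
  have hlarge : max Q (2 ^ N) < r.2 := by
    by_contra hcon
    refine hrQ ⟨hrP.1, not_lt.1 hcon, fun i => (hle i).trans ?_⟩
    exact div_le_self (abs_nonneg _) (Real.one_le_rpow hq1 hc'.le)
  have hne : r.2 ≠ 0 := hrP.1.ne'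
  refine ⟨Nat.log 2 r.2, ?_, r, hrP, Nat.pow_log_le_self 2 hne,
    Nat.lt_pow_succ_log_self one_lt_two _, ?_⟩
  · exact Nat.le_log_of_pow_le one_lt_two ((le_max_right _ _).trans hlarge.le)
  · refine (dist_ratPoint_le x r hle (by positivity)).trans ?_
    have h1 : (r.2 : ℝ) ^ c' = (r.2 : ℝ) ^ (c' - c) * (r.2 : ℝ) ^ c := by
      rw [← Real.rpow_add hq0, sub_add_cancel]
    have h2 : ((2 : ℝ) ^ c) ^ Nat.log 2 r.2 ≤ (r.2 : ℝ) ^ c := by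
      rw [Real.rpow_pow_comm (by norm_num)]
      gcongr
      exact_mod_cast Nat.pow_log_le_self 2 hne
    calc d * (|C| / (r.2 : ℝ) ^ c') = d * |C| / (r.2 : ℝ) ^ (c' - c) / (r.2 : ℝ) ^ c := by
          rw [h1]
          field_simp
      _ ≤ κ / (r.2 : ℝ) ^ c := by
          gcongr
          exact hQ _ ((le_max_left _ _).trans hlarge.le)
      _ ≤ κ / ((2 : ℝ) ^ c) ^ Nat.log 2 r.2 := by gcongr

end Approximation

/-! ### The dimension bound -/

section Dimension

variable {d k : ℕ} {e : ℤ} {b : Fin d → ℤ} {A : Matrix (Fin d) (Fin d) ℤ}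
  {U : Set (EuclideanSpace ℝ (Fin k))}
  {Ψ : EuclideanSpace ℝ (Fin k) → EuclideanSpace ℝ (Fin d)}
  {μ : Measure (EuclideanSpace ℝ (Fin k))} {α δ ρ₀ a C : ℝ}

/-- Small separated subsets of a bounded part of the support have at most a constant times
`ρ ^ (-δ)` points. -/
lemma DecayEstimate.exists_card_le [IsLocallyFiniteMeasure μ] (h : DecayEstimate μ α δ ρ₀ a C)
    (y₀ : EuclideanSpace ℝ (Fin k)) (η : ℝ) :
    ∃ C₁ : ℝ, 0 ≤ C₁ ∧ ∀ ρ : ℝ, 0 < ρ → ρ ≤ 1 → ρ ≤ ρ₀ →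
      ∀ S : Finset (EuclideanSpace ℝ (Fin k)), Separated ρ S → (∀ s ∈ S, s ∈ μ.support) →
        (∀ s ∈ S, s ∈ Metric.ball y₀ η) → (S.card : ℝ) ≤ C₁ * ρ ^ (-δ) := by
  have ha := h.low_pos
  have hfin : μ (Metric.closedBall y₀ (η + 1)) ≠ ⊤ :=
    (isCompact_closedBall y₀ (η + 1)).measure_lt_top.ne
  set m := (μ (Metric.closedBall y₀ (η + 1))).toReal with hm
  refine ⟨m * 3 ^ δ / a, by positivity, ?_⟩
  intro ρ hρ0 hρ1 hρ S hS hsupp hball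
  have h1 := h.card_mul_le (m := m) hρ0 hρ ENNReal.toReal_nonneg hS hsupp
    (A := Metric.closedBall y₀ (η + 1))
    (by
      intro s hs y hy
      have h2 := hball s hs
      rw [Metric.mem_ball] at h2
      rw [Metric.mem_closedBall] at hy ⊢
      linarith [dist_triangle y s y₀])
    (by rw [hm, ENNReal.ofReal_toReal hfin])
  rw [← le_div_iff₀ (by positivity)] at h1
  refine h1.trans (le_of_eq ?_)
  rw [Real.div_rpow hρ0.le (by norm_num), Real.rpow_neg hρ0.le]
  field_simp

/-- A point of the domain of the chart has a neighbourhood in which the points whose image has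
exponent greater than `c` form a set of dimension at most `s`. At level `n` this neighbourhood is
cut into balls of radius `ρ = κ / 2 ^ n`; the relevant rational points close to the image of such
a ball lie in one hyperplane, transversal to the chart, and the points of the support within
`r = κ / 2 ^ (n c)` of the preimage of the hyperplane are covered by `O((ρ / r) ^ (δ - α))` balls
of radius `r`. -/
lemma exists_ball_dimH_le [IsLocallyFiniteMeasure μ] (h : DecayEstimate μ α δ ρ₀ a C)
    (hk : k + 1 = d) (hdeg : (quadPoly e b A).totalDegree = 2)
    (hirr : Irreducible (MvPolynomial.map (Int.castRingHom ℚ) (quadPoly e b A)))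
    (hΨ : IsLocalChart 2 U Ψ (regularPart (quadPoly e b A)))
    {c s : ℝ} (hc : 1 ≤ c) (hs : 0 < s) (hcs : δ - α * (1 - 1 / c) < s)
    {y₀ : EuclideanSpace ℝ (Fin k)} (hy₀ : y₀ ∈ U) :
    ∃ η : ℝ, 0 < η ∧ dimH {y | y ∈ μ.support ∧ y ∈ Metric.ball y₀ η ∧
      (c : EReal) < intrinsicExponent (quadPoly e b A) (Ψ y)} ≤ ENNReal.ofReal s := by
  classical
  obtain ⟨η, M, c₀, hη, hM, hc₀, -, hLip, hTaylor, hgrad⟩ := hΨ.exists_local_bounds hk hy₀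
  obtain ⟨C₂, hC₂, hform⟩ := exists_abs_form_le A
  have hρ₀ := h.rho_pos
  have hc0 : 0 < c := by linarith
  -- the ball is small enough for its image to stay well inside the ball of radius `η`
  set η' := min η (η / (2 * M)) with hη'
  have hη'0 : 0 < η' := lt_min hη (by positivity)
  have hsub : Metric.ball y₀ η' ⊆ Metric.ball y₀ η := Metric.ball_subset_ball (min_le_left _ _)
  obtain ⟨κ, hκ0, hκ1, hκρ, hκη, hκC⟩ : ∃ κ : ℝ, 0 < κ ∧ κ ≤ 1 ∧ 2 * κ ≤ ρ₀ ∧ κ < η / 2 ∧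
      C₂ * ((2 + 2 * M) * κ) ^ 2 * 4 < 1 := by
    have h1 : Filter.Tendsto (fun κ : ℝ => C₂ * ((2 + 2 * M) * κ) ^ 2 * 4) (nhds 0) (nhds 0) := by
      have : Continuous (fun κ : ℝ => C₂ * ((2 + 2 * M) * κ) ^ 2 * 4) := by fun_prop
      simpa using this.tendsto 0
    have h2 := (h1.eventually_lt_const (zero_lt_one)).filter_mono
      (nhdsWithin_le_nhds (s := Set.Ioi (0 : ℝ)))
    have h3 : ∀ᶠ κ : ℝ in nhdsWithin 0 (Set.Ioi 0), κ < min 1 (min (ρ₀ / 2) (η / 2)) :=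
      (Filter.eventually_of_mem (Iio_mem_nhds (by positivity)) fun _ hx => hx).filter_mono
        nhdsWithin_le_nhds
    obtain ⟨κ, ⟨hκ2, hκ3⟩, hκ4⟩ := ((h2.and h3).and self_mem_nhdsWithin).exists
    rw [lt_min_iff, lt_min_iff] at hκ3
    exact ⟨κ, hκ4, hκ3.1.le, by linarith [hκ3.2.1], hκ3.2.2, hκ2⟩
  set l : ℝ := (2 : ℝ) ^ c with hl
  have hl2 : 2 ≤ l := by
    have := Real.rpow_le_rpow_of_exponent_le (one_le_two (α := ℝ)) hc
    rwa [Real.rpow_one] at this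
  have hl0 : 0 < l := by linarith
  obtain ⟨j, hj⟩ : ∃ j : ℕ, l ≤ 2 ^ (2 ^ j) := by
    obtain ⟨j, hj⟩ := pow_unbounded_of_one_lt c (one_lt_two)
    refine ⟨j, ?_⟩
    rw [hl, ← Real.rpow_natCast]
    apply Real.rpow_le_rpow_of_exponent_le one_le_two
    push_cast
    exact hj.le
  obtain ⟨B₁, hB₁, hcount⟩ := h.card_le_of_near_hypersurface zero_le_one hM.le hc₀ j
  obtain ⟨B₂, hB₂, hcard⟩ := h.exists_card_le y₀ η'
  refine ⟨η', hη'0, ?_⟩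
  let E : ℕ → Set (EuclideanSpace ℝ (Fin k)) := fun n => {y | y ∈ μ.support ∧
    y ∈ Metric.ball y₀ η' ∧ ∃ r ∈ rationalPoints (quadPoly e b A), r.2 < 2 ^ (n + 1) ∧
      dist (Ψ y) (ratPoint r) ≤ κ / l ^ n}
  have hEsub : {y | y ∈ μ.support ∧ y ∈ Metric.ball y₀ η' ∧
      (c : EReal) < intrinsicExponent (quadPoly e b A) (Ψ y)} ⊆
      {y | ∃ᶠ n in Filter.atTop, y ∈ E n} := by
    rintro y ⟨h1, h2, h3⟩
    refine (frequently_exists_close hc0.le hκ0 h3).mono ?_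
    rintro n ⟨r, hr, -, hr2, hr3⟩
    exact ⟨h1, h2, r, hr, hr2, hr3⟩
  refine (dimH_mono hEsub).trans ?_
  have hcover : ∀ n, ∀ S : Finset (EuclideanSpace ℝ (Fin k)),
      (S : Set (EuclideanSpace ℝ (Fin k))) ⊆ E n →
      Separated (κ / l ^ n) S →
      (S.card : ℝ) ≤ B₂ * (κ / 2 ^ n) ^ (-δ) * (B₁ * ((κ / 2 ^ n) / (κ / l ^ n)) ^ (δ - α)) := by
    intro n S hSE hS
    have hρ0 : 0 < κ / 2 ^ n := by positivity
    have hr0 : 0 < κ / l ^ n := by positivity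
    have hrρ : κ / l ^ n ≤ κ / 2 ^ n := by gcongr
    have hρκ : κ / 2 ^ n ≤ κ := div_le_self hκ0.le (one_le_pow₀ one_le_two)
    have hrpow : (κ / 2 ^ n) ^ (2 ^ j) ≤ κ / l ^ n := by
      rw [div_pow, ← pow_mul, mul_comm n, pow_mul]
      gcongr
      exact pow_le_of_le_one hκ0.le hκ1 (by positivity)
    have hScard : ∀ S' : Finset (EuclideanSpace ℝ (Fin k)), S' ⊆ S →
        Separated (κ / 2 ^ n) S' → (S'.card : ℝ) ≤ B₂ * (κ / 2 ^ n) ^ (-δ) := fun S' h1 h2 =>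
      hcard _ hρ0 (hρκ.trans hκ1) (by linarith) S' h2 (fun y hy => (hSE (h1 hy)).1)
        (fun y hy => (hSE (h1 hy)).2.1)
    obtain ⟨T, hTS, hTsep, hTcov⟩ := exists_separated_cover
      (S : Set (EuclideanSpace ℝ (Fin k))) hρ0.le _ fun S' h1 => hScard S' (Finset.coe_subset.1 h1)
    have hpiece : ∀ t ∈ T, ((S.filter fun y => dist y t ≤ κ / 2 ^ n).card : ℝ) ≤
        B₁ * ((κ / 2 ^ n) / (κ / l ^ n)) ^ (δ - α) := by
      intro t ht
      have htE := hSE (hTS ht)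
      have hSt : ∀ y ∈ S.filter fun y => dist y t ≤ κ / 2 ^ n, y ∈ E n ∧ dist y t ≤ κ / 2 ^ n :=
        fun y hy => ⟨hSE (Finset.mem_filter.1 hy).1, (Finset.mem_filter.1 hy).2⟩
      set St := S.filter fun y => dist y t ≤ κ / 2 ^ n with hStdef
      set R : Set ((Fin d → ℤ) × ℕ) := {r | r ∈ rationalPoints (quadPoly e b A) ∧
        r.2 < 2 ^ (n + 1) ∧ ∃ y ∈ Metric.ball y₀ η', dist y t ≤ κ / 2 ^ n ∧
          dist (Ψ y) (ratPoint r) ≤ κ / l ^ n} with hR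
      obtain ⟨-, htball, r₀, hr₀, hr₀q, hr₀d⟩ := htE
      have hr₀R : r₀ ∈ R :=
        ⟨hr₀, hr₀q, t, htball, by rw [dist_self]; exact hρ0.le, hr₀d⟩
      have hr₀ball : ratPoint r₀ ∈ Metric.ball (Ψ y₀) η := by
        rw [Metric.mem_ball]
        have h1 := hLip t (hsub htball) y₀ (Metric.mem_ball_self hη)
        have h2 : M * dist t y₀ ≤ M * (η / (2 * M)) := by
          have := (Metric.mem_ball.1 htball).le.trans (min_le_right _ _)
          gcongr
        have h3 : M * (η / (2 * M)) = η / 2 := by field_simp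
        have h4 := dist_triangle_left (ratPoint r₀) (Ψ y₀) (Ψ t)
        linarith
      obtain ⟨hg0, hadj⟩ := hgrad _ hr₀ball
      obtain ⟨w, hw1, hwg, hwR⟩ := exists_unit_normal hdeg hirr hC₂ hform hκC (n := n) (R := R)
        (fun r hr => hr.1) (fun r hr => hr.2.1)
        (by
          rintro r ⟨-, -, y, hy, hyt, hyr⟩ r' ⟨-, -, y', hy', hyt', hyr'⟩
          have h1 := hLip y (hsub hy) y' (hsub hy')
          have h2 : M * dist y y' ≤ M * (2 * (κ / 2 ^ n)) := by
            have := dist_triangle_right y y' t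
            gcongr
            linarith
          have h3 := dist_triangle4 (ratPoint r) (Ψ y) (Ψ y') (ratPoint r')
          rw [dist_comm] at hyr
          have h4 : (2 + 2 * M) * κ / 2 ^ n = 2 * (κ / 2 ^ n) + M * (2 * (κ / 2 ^ n)) := by ring
          linarith)
        hr₀R hg0
      refine hcount (Metric.ball y₀ η) (fun y => inner ℝ w (Ψ y - ratPoint r₀))
        (fun y => (fderiv ℝ Ψ y).adjoint w) ?_ ?_ (κ / l ^ n) (κ / 2 ^ n) hr0 hrρ (by linarith)
        (by linarith) hrpow t (hSE (hTS ht)).1 (hsub htball) St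
        (hS.mono (Finset.filter_subset _ _)) (fun y hy => (hSt y hy).1.1)
        (fun y hy => hsub (hSt y hy).1.2.1) (fun y hy => (hSt y hy).2) ?_
      · intro x hx
        have := hadj x hx w hwg
        rwa [hw1, mul_one] at this
      · intro x hx y hy
        have h1 : inner ℝ w (Ψ y - ratPoint r₀) - inner ℝ w (Ψ x - ratPoint r₀) -
            inner ℝ ((fderiv ℝ Ψ x).adjoint w) (y - x) =
            inner ℝ w (Ψ y - Ψ x - fderiv ℝ Ψ x (y - x)) := by
          rw [ContinuousLinearMap.adjoint_inner_left, ← inner_sub_right, ← inner_sub_right,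
            sub_sub_sub_cancel_right]
        rw [h1]
        refine (abs_real_inner_le_norm _ _).trans ?_
        rw [hw1, one_mul]
        exact hTaylor x hx y hy
      · intro y hy
        obtain ⟨⟨-, hyball, r, hr, hrq, hrd⟩, hyt⟩ := hSt y hy
        have h1 := hwR r ⟨hr, hrq, y, hyball, hyt, hrd⟩
        have h2 : inner ℝ w (Ψ y - ratPoint r₀) = inner ℝ w (Ψ y - ratPoint r) := by
          rw [← sub_add_sub_cancel (Ψ y) (ratPoint r) (ratPoint r₀), inner_add_right, h1, add_zero]
        change |inner ℝ w (Ψ y - ratPoint r₀)| ≤ _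
        rw [h2, one_mul]
        refine (abs_real_inner_le_norm _ _).trans ?_
        rw [hw1, one_mul, ← dist_eq_norm]
        exact hrd
    have hunion : S ⊆ T.biUnion fun t => S.filter fun y => dist y t ≤ κ / 2 ^ n := by
      intro y hy
      obtain ⟨t, ht, hyt⟩ := hTcov y hy
      exact Finset.mem_biUnion.2 ⟨t, ht, Finset.mem_filter.2 ⟨hy, hyt⟩⟩
    calc (S.card : ℝ) ≤ ((∑ t ∈ T, (S.filter fun y => dist y t ≤ κ / 2 ^ n).card : ℕ) : ℝ) := by
          exact_mod_cast (Finset.card_le_card hunion).trans Finset.card_biUnion_le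
      _ = ∑ t ∈ T, ((S.filter fun y => dist y t ≤ κ / 2 ^ n).card : ℝ) := by push_cast; rfl
      _ ≤ ∑ t ∈ T, B₁ * ((κ / 2 ^ n) / (κ / l ^ n)) ^ (δ - α) := Finset.sum_le_sum hpiece
      _ = T.card * (B₁ * ((κ / 2 ^ n) / (κ / l ^ n)) ^ (δ - α)) := by
          rw [Finset.sum_const, nsmul_eq_mul]
      _ ≤ _ := by
          gcongr
          exact hScard T (Finset.coe_subset.1 hTS) hTsep
  -- the ratio of the geometric series is `2` to the power `c (δ - s) - α (c - 1)`
  set q : ℝ := 2 ^ (δ + (c - 1) * (δ - α) - c * s) with hq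
  have hq1 : q < 1 := by
    apply Real.rpow_lt_one_of_one_lt_of_neg one_lt_two
    have h1 : c * (δ - α * (1 - 1 / c)) < c * s := by gcongr
    have h2 : c * (δ - α * (1 - 1 / c)) = δ + (c - 1) * (δ - α) := by
      field_simp
      ring
    linarith
  refine dimH_limsup_le (E := E)
    (N := fun n => B₂ * (κ / 2 ^ n) ^ (-δ) * (B₁ * ((κ / 2 ^ n) / (κ / l ^ n)) ^ (δ - α)))
    (r := fun n => κ / l ^ n) (A := B₂ * κ ^ (-δ) * B₁ * (2 * κ) ^ s) (q := q) hs
    (fun n => by positivity) ?_ (by positivity) (by positivity) hq1 ?_ (n₀ := 0) ?_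
  · exact (tendsto_pow_atTop_atTop_of_one_lt (by linarith)).const_div_atTop κ
  · intro n
    apply le_of_eq
    have e1 : (κ / 2 ^ n) ^ (-δ) = κ ^ (-δ) * ((2 : ℝ) ^ δ) ^ n := by
      rw [Real.div_rpow hκ0.le (by positivity), ← Real.rpow_pow_comm (by norm_num),
        Real.rpow_neg zero_le_two, inv_pow, div_inv_eq_mul]
    have e2 : ((κ / 2 ^ n) / (κ / l ^ n)) ^ (δ - α) = ((2 : ℝ) ^ ((c - 1) * (δ - α))) ^ n := by
      have h1 : (κ / 2 ^ n) / (κ / l ^ n) = ((2 : ℝ) ^ (c - 1)) ^ n := by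
        rw [Real.rpow_sub two_pos, Real.rpow_one, ← hl, div_pow]
        field_simp
      rw [h1, ← Real.rpow_pow_comm (by positivity), ← Real.rpow_mul zero_le_two]
    have e3 : (2 * (κ / l ^ n)) ^ s = (2 * κ) ^ s * ((2 : ℝ) ^ (-(c * s))) ^ n := by
      rw [← mul_div_assoc, Real.div_rpow (by positivity) (by positivity),
        ← Real.rpow_pow_comm hl0.le, hl, ← Real.rpow_mul zero_le_two,
        Real.rpow_neg zero_le_two, inv_pow, div_eq_mul_inv]
    have e4 : q ^ n = ((2 : ℝ) ^ δ) ^ n * ((2 : ℝ) ^ ((c - 1) * (δ - α))) ^ n *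
        ((2 : ℝ) ^ (-(c * s))) ^ n := by
      rw [← mul_pow, ← mul_pow, ← Real.rpow_add two_pos, ← Real.rpow_add two_pos, hq,
        sub_eq_add_neg]
    rw [e1, e2, e3, e4]
    ring
  · intro n _
    obtain ⟨T, hTE, hTsep, hTcov⟩ := exists_separated_cover (E n)
      (by positivity : 0 ≤ κ / l ^ n) _ (hcover n)
    exact ⟨T, hcover n T hTE hTsep, hTcov⟩

/-- The dimension bound in the domain of the chart. -/
lemma dimH_preimage_wellApproximable_le [IsLocallyFiniteMeasure μ]
    (h : DecayEstimate μ α δ ρ₀ a C)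
    (hk : k + 1 = d) (hdeg : (quadPoly e b A).totalDegree = 2)
    (hirr : Irreducible (MvPolynomial.map (Int.castRingHom ℚ) (quadPoly e b A)))
    (hΨ : IsLocalChart 2 U Ψ (regularPart (quadPoly e b A))) (hU : μ.support ⊆ U)
    {c : ℝ} (hc : 1 ≤ c) :
    dimH {y | y ∈ μ.support ∧ (c : EReal) < intrinsicExponent (quadPoly e b A) (Ψ y)} ≤
      ENNReal.ofReal (δ - α * (1 - 1 / c)) := by
  by_contra! hcon
  obtain ⟨s, hs1, hs2⟩ := ENNReal.lt_iff_exists_nnreal_btwn.1 hcon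
  have hs0 : 0 < s := by exact_mod_cast (zero_le (a := ENNReal.ofReal _)).trans_lt hs1
  have hs1' : δ - α * (1 - 1 / c) < s := by
    rw [← ENNReal.ofReal_coe_nnreal] at hs1
    exact (ENNReal.ofReal_lt_ofReal_iff (by exact_mod_cast hs0)).1 hs1
  obtain ⟨y₀, hy₀, hlt⟩ := exists_mem_nhdsWithin_lt_dimH_of_lt_dimH hs2
  obtain ⟨η, hη, hle⟩ := exists_ball_dimH_le h hk hdeg hirr hΨ hc (s := s)
    (by exact_mod_cast hs0) hs1' (hU hy₀.1)
  rw [ENNReal.ofReal_coe_nnreal] at hle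
  refine absurd hle (not_le.2 (hlt _ ?_))
  filter_upwards [self_mem_nhdsWithin, mem_nhdsWithin_of_mem_nhds (Metric.ball_mem_nhds y₀ hη)]
    with y h1 h2
  exact ⟨h1.1, h2, h1.2⟩

end Dimension

end IntrinsicApprox

theorem theorem1p2 (d : ℕ) (hd : 2 ≤ d)
    (P : MvPolynomial (Fin d) ℤ) (hPdeg : P.totalDegree = 2)
    (hPirr : Irreducible (MvPolynomial.map (Int.castRingHom ℚ) P))
    (α δ : ℝ) (μ : Measure (EuclideanSpace ℝ (Fin (d - 1))))
    (hfriendly : IntrinsicApprox.IsAbsolutelyFriendly α μ)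
    (hregular : IntrinsicApprox.IsAhlforsRegular δ μ)
    (U : Set (EuclideanSpace ℝ (Fin (d - 1)))) (hU : μ.support ⊆ U)
    (Ψ : EuclideanSpace ℝ (Fin (d - 1)) → EuclideanSpace ℝ (Fin d))
    (hΨ : IntrinsicApprox.IsLocalChart 2 U Ψ (IntrinsicApprox.regularPart P))
    (ν : Measure (EuclideanSpace ℝ (Fin d))) (hν : ν = μ.map Ψ)
    (c : ℝ) (hc : 1 ≤ c) :
    dimH (IntrinsicApprox.wellApproximable P c ∩ (ν.support ∩ Ψ '' U)) ≤
        ENNReal.ofReal (δ - α * (1 - 1 / c)) ∧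
      (IsCompact μ.support →
        dimH (IntrinsicApprox.wellApproximable P c ∩ ν.support) ≤
          ENNReal.ofReal (δ - α * (1 - 1 / c))) := by
  subst hν
  obtain ⟨e, b, A, rfl⟩ := IntrinsicApprox.exists_eq_quadPoly hPdeg.le
  obtain ⟨ρ₀, a, C, h⟩ := IntrinsicApprox.exists_decayEstimate hfriendly.decaying hregular
  have := hfriendly.locallyFinite
  have hcont : ContinuousOn Ψ U := hΨ.contDiffOn.continuousOn
  have hdim := IntrinsicApprox.dimH_preimage_wellApproximable_le h (Nat.sub_add_cancel (by omega))
    hPdeg hPirr hΨ hU hc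
  set W := {y | y ∈ μ.support ∧
    (c : EReal) < IntrinsicApprox.intrinsicExponent (IntrinsicApprox.quadPoly e b A) (Ψ y)}
  have himage : dimH (Ψ '' W) ≤ ENNReal.ofReal (δ - α * (1 - 1 / c)) := by
    refine (dimH_image_le_of_locally_lipschitzOn fun y hy => ?_).trans hdim
    obtain ⟨K, t, ht, hK⟩ := ((hΨ.contDiffAt (hU hy.1)).of_le
      (by norm_num : (1 : WithTop ℕ∞) ≤ 2)).exists_lipschitzOnWith
    exact ⟨K, t, mem_nhdsWithin_of_mem_nhds ht, hK⟩
  refine ⟨(dimH_mono ?_).trans himage, fun hcompact => (dimH_mono ?_).trans himage⟩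
  · rintro _ ⟨hW, hsupp, y, hy, rfl⟩
    exact ⟨y, ⟨IntrinsicApprox.mem_support_of_mem_support_map hΨ.isOpen_source hU hcont
      hΨ.isEmbedding hy hsupp, hW.2⟩, rfl⟩
  · rintro x ⟨hW, hsupp⟩
    obtain ⟨y, hy, rfl⟩ := IntrinsicApprox.support_map_subset_of_isCompact hΨ.isOpen_source hU
      hcont hcompact hsupp
    exact ⟨y, ⟨hy, hW.2⟩, rfl⟩
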